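/- Let $\Lambda\subset\mathbb{R}$ be a bounded interval with endpoints $a<b$ and length $l(\Lambda)=b-a$. Write $\mathbb{H}=L^2(\Lambda;\mathbb{R}^3)$ and $\mathbb{H}^1=H^1(\Lambda;\mathbb{R}^3)$, with $|u|_{\mathbb{H}^1}^2=|u|_{\mathbb{H}}^2+|Du|_{\mathbb{H}}^2$, where $D$ is the weak derivative; let $D(A)=\{u\in H^2(\Lambda;\mathbb{R}^3): Du=0 \text{ at both endpoints of }\Lambda\}$. Let $\alpha,\beta>0$ and let $k>0$ be a constant such that $$\sup_{x\in\Lambda}|u(x)|_{\mathbb{R}^3}\le k\,|u|_{\mathbb{H}}^{1/2}\,|u|_{\mathbb{H}^1}^{1/2}\qquad\text{for all }u\in\mathbb{H}^1 .$$ Let $u_0\in\mathbb{H}^1$ with $|u_0(x)|_{\mathbb{R}^3}=1$ for all $x\in\Lambda$. Let $y\in C([0,\infty);\mathbb{H}^1)$, with $y\in L^2(0,T;D(A))$ for every $T>0$, be the solution of the deterministic Landau–Lifshitz equation with shape anisotropy and zero applied field, that is, $$y(t)=u_0+\int_0^t\Big[y(s)\times h(s)-\alpha\,y(s)\times\big(y(s)\times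 h(s)\big)\Big]ds\quad\text{in }\mathbb{H}\text{ for all }t\ge 0,\qquad h(s)=\Delta y(s)-\beta\,(0,y_2(s),y_3(s))^{\mathrm T}.$$ Let $\zeta$ be one of the two constant states $(-1,0,0)^{\mathrm T}$ and $(1,0,0)^{\mathrm T}$, and suppose that $$|u_0-\zeta|_{\mathbb{H}^1}<\frac{1}{2k^2\sqrt{l(\Lambda)}}\,\frac{\alpha}{1+2\alpha}.$$ Then $y(t)$ converges to $\zeta$ in $\mathbb{H}^1$ as $t\to\infty$. -/

import Mathlib

open MeasureTheory Set Filter Topology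

namespace LandauLifshitz

noncomputable section

/-- Three-dimensional Euclidean space. -/
abbrev R3 : Type := EuclideanSpace ℝ (Fin 3)

/-- The vector product on `R3`. -/
def cross (v w : R3) : R3 := WithLp.toLp 2 (crossProduct v.ofLp w.ofLp)

/-- The space `L²(Λ; ℝ³)`, where `Λ` is the interval with endpoints `a` and `b`. -/
abbrev L2 (a b : ℝ) : Type := Lp R3 2 (volume.restrict (Ioo a b))

/-- `g` is the weak derivative of `u` on the interval with endpoints `a` and `b`. -/
def IsWeakDeriv {a b : ℝ} (u g : L2 a b) : Prop :=
  ∀ φ : ℝ → ℝ, ContDiff ℝ ((⊤ : ℕ∞) : WithTop ℕ∞) φ → HasCompactSupport φ →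
    tsupport φ ⊆ Ioo a b →
      ∫ x in Ioo a b, deriv φ x • u x = - ∫ x in Ioo a b, φ x • g x

theorem integrable_smul_L2 {a b : ℝ} {ψ : ℝ → ℝ} (hc : Continuous ψ) (hs : HasCompactSupport ψ)
    (u : L2 a b) : Integrable (fun x => ψ x • u x) (volume.restrict (Ioo a b)) := by
  have hu : Integrable u (volume.restrict (Ioo a b)) := (Lp.memLp u).integrable one_le_two
  obtain ⟨C, hC⟩ := hc.bounded_above_of_compact_support hs
  exact hu.bdd_smul C hc.aestronglyMeasurable (Eventually.of_forall hC)

/-- The Sobolev space `H¹(Λ; ℝ³)`, realised as the space of the pairs `(u, Du)` in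
`L²(Λ; ℝ³) × L²(Λ; ℝ³)`. Its norm is `(|u|² + |Du|²)^(1/2)`, with norms of `L²(Λ; ℝ³)`. -/
def H1 (a b : ℝ) : Submodule ℝ (WithLp 2 (L2 a b × L2 a b)) where
  carrier := {p | IsWeakDeriv p.fst p.snd}
  zero_mem' := by
    intro φ _ _ _
    have h : ∀ ψ : ℝ → ℝ, ∫ x in Ioo a b, ψ x • (0 : L2 a b) x = 0 := by
      intro ψ
      refine integral_eq_zero_of_ae ?_
      filter_upwards [Lp.coeFn_zero R3 2 (volume.restrict (Ioo a b))] with x hx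
      rw [hx]; simp
    simp only [WithLp.zero_fst, WithLp.zero_snd, h, neg_zero]
  add_mem' := by
    intro p q hp hq φ h1 h2 h3
    have hd : Continuous (deriv φ) := h1.continuous_deriv (by simp)
    have h : ∀ ψ : ℝ → ℝ, Continuous ψ → HasCompactSupport ψ → ∀ u v : L2 a b,
        ∫ x in Ioo a b, ψ x • (u + v) x
          = (∫ x in Ioo a b, ψ x • u x) + ∫ x in Ioo a b, ψ x • v x := by
      intro ψ hψ hs u v
      rw [← integral_add (integrable_smul_L2 hψ hs u) (integrable_smul_L2 hψ hs v)]
      refine integral_congr_ae ?_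
      filter_upwards [Lp.coeFn_add u v] with x hx
      rw [hx, Pi.add_apply, smul_add]
    simp only [WithLp.add_fst, WithLp.add_snd]
    rw [h _ hd h2.deriv, h _ h1.continuous h2, hp φ h1 h2 h3, hq φ h1 h2 h3]
    abel
  smul_mem' := by
    intro c p hp φ h1 h2 h3
    have h : ∀ (ψ : ℝ → ℝ) (u : L2 a b),
        ∫ x in Ioo a b, ψ x • (c • u) x = c • ∫ x in Ioo a b, ψ x • u x := by
      intro ψ u
      rw [← integral_smul]
      refine integral_congr_ae ?_
      filter_upwards [Lp.coeFn_smul c u] with x hx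
      simp only [hx, Pi.smul_apply]
      rw [smul_comm]
    simp only [WithLp.smul_fst, WithLp.smul_snd]
    rw [h, h, hp φ h1 h2 h3, smul_neg]

/-- The element of `L²(Λ; ℝ³)` underlying an element of `H¹(Λ; ℝ³)`. -/
def val {a b : ℝ} (u : H1 a b) : L2 a b := (u : WithLp 2 (L2 a b × L2 a b)).fst

/-- The weak derivative `Du` of an element `u` of `H¹(Λ; ℝ³)`. -/
def weakD {a b : ℝ} (u : H1 a b) : L2 a b := (u : WithLp 2 (L2 a b × L2 a b)).snd

/-- The constant function `v`, as an element of `L²(Λ; ℝ³)`. -/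
def constL2 (a b : ℝ) (v : R3) : L2 a b := (memLp_const v).toLp (fun _ => v)

/-- The constant function `v`, as an element of `H¹(Λ; ℝ³)`; its weak derivative is `0`. -/
def constH1 (a b : ℝ) (v : R3) : H1 a b :=
  ⟨WithLp.toLp 2 (constL2 a b v, 0), by
    intro φ h1 h2 h3
    have e1 : ∫ x in Ioo a b, deriv φ x • (constL2 a b v) x
        = ∫ x in Ioo a b, deriv φ x • v := by
      refine integral_congr_ae ?_
      filter_upwards [(memLp_const (μ := volume.restrict (Ioo a b)) (p := 2) v).coeFn_toLp]
        with x hx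
      rw [constL2, hx]
    have e2 : ∫ x in Ioo a b, φ x • (0 : L2 a b) x = 0 := by
      refine integral_eq_zero_of_ae ?_
      filter_upwards [Lp.coeFn_zero R3 2 (volume.restrict (Ioo a b))] with x hx
      rw [hx]; simp
    have e3 : ∫ x in Ioo a b, deriv φ x = 0 := by
      have hsub : Function.support (deriv φ) ⊆ Ioo a b :=
        (support_deriv_subset).trans h3
      rw [setIntegral_eq_integral_of_forall_compl_eq_zero
        (fun x hx => Function.notMem_support.1 (fun h => hx (hsub h)))]
      exact integral_eq_zero_of_hasDerivAt_of_integrable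
        (fun x => (h1.differentiable (by simp) x).hasDerivAt)
        ((h1.continuous_deriv (by simp)).integrable_of_hasCompactSupport h2.deriv)
        (h1.continuous.integrable_of_hasCompactSupport h2)
    change ∫ x in Ioo a b, deriv φ x • (constL2 a b v) x
      = -∫ x in Ioo a b, φ x • (0 : L2 a b) x
    rw [e1, e2, integral_smul_const, e3, zero_smul, neg_zero]⟩

/-- `u` belongs to `H²(Λ; ℝ³)`, satisfies the boundary condition `Du = 0` at both endpoints
(`Du` is identified with its continuous representative on the closed interval), and `f = Δu`. -/
def IsNeumannLaplacian {a b : ℝ} (u : H1 a b) (f : L2 a b) : Prop :=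
  IsWeakDeriv (weakD u) f ∧
    ∃ g : ℝ → R3, ContinuousOn g (Icc a b) ∧ g =ᵐ[volume.restrict (Ioo a b)] weakD u ∧
      g a = 0 ∧ g b = 0

/-- The Landau–Lifshitz right-hand side `v × h - α v × (v × h)` at a point, where
`h = w - β (0, v₂, v₃) + K` is the effective field, `v` is the value of the magnetization,
`w` that of its Laplacian and `K` that of the applied field. -/
def llRHS (α β : ℝ) (K v w : R3) : R3 :=
  let h : R3 := w - β • !₂[0, v 1, v 2] + K
  cross v h - α • cross v (cross v h)

/-- `y` is a solution on the time interval `[0, ∞)` of the deterministic Landau–Lifshitz equation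
with damping parameter `α`, shape anisotropy parameter `β`, applied field `K` (constant in
space) and initial state `u₀`: it belongs to `C([0, ∞); H¹)`, for all `T` to `L²(0, T; D(A))`,
where `A` is minus the Neumann Laplacian, and the equation holds in integrated form, with a
Bochner integral in `L²(Λ; ℝ³)`. Here `Δy t` is the Laplacian of `y t`, and `F t` is the
right-hand side at time `t`. -/
def IsSolution {a b : ℝ} (α β : ℝ) (K : ℝ → R3) (u₀ : H1 a b) (y : ℝ → H1 a b) : Prop :=
  ContinuousOn y (Ici 0) ∧
    ∃ Δy F : ℝ → L2 a b,
      (∀ᵐ t ∂(volume.restrict (Ioi (0 : ℝ))), IsNeumannLaplacian (y t) (Δy t)) ∧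
      (∀ T : ℝ, 0 < T → MemLp Δy 2 (volume.restrict (Ioo 0 T))) ∧
      (∀ᵐ t ∂(volume.restrict (Ioi (0 : ℝ))),
        F t =ᵐ[volume.restrict (Ioo a b)] fun x => llRHS α β (K t) (val (y t) x) (Δy t x)) ∧
      ∀ t : ℝ, 0 ≤ t → IntervalIntegrable F volume 0 t ∧
        val (y t) = val u₀ + ∫ s in (0 : ℝ)..t, F s

end

end LandauLifshitz

/-!
Write `ζ = (σ, 0, 0)` with `σ = ±1`, `v = y t`, `p = Dv`, `q = Δv`, `f = (0, v₁, v₂)`, and let `F`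
be the right-hand side of the equation. The proof shows that `X t = |y t - ζ|²` (norm of `H¹`) is
a strict Lyapunov function near `ζ`.

Since `F` is pointwise orthogonal to `v`, the length of `v` stays equal to `1`
(`ae_norm_eq_one`). Differentiating `|v|² = 1` twice in space gives `v · p = 0` and
`v · q = -|p|²`. With these relations, and up to a divergence that integrates to zero by the
Neumann condition, `F · (2 (v - ζ) - 2 q)` is at most `-min α (αβ/2) (|v - ζ|² + |p|²)` wherever
`|v - ζ|² (1 + 2α) ≤ α` and `|v - ζ| ≤ 1` (`inner_llRHS_le`, integrated in
`inner_le_neg_mul_norm_sq`). The favourable terms are `-α (ζ · v) (|p|² + β |f|²)`, from the `L²`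
part of the norm, and `-αβ |Df|² - α (|q|² - (q · v)²)`, from the gradient part; the others are
`|p|²` times a factor that vanishes with `|v - ζ|`, because `p · (ζ × Df) = 0` and
`σ p₀ = (ζ - v) · p`.

The time derivative of `X` has to be justified for `y` in `L²(0, T; D(A))` with `F` in
`L²(0, T; L²)`. Only an upper bound is needed. By Green's formula `2 (v - ζ) - 2 q` is a
subgradient of the squared `H¹` distance (`norm_sq_sub_norm_sq_le`), which bounds the backward
difference quotients of `X`; averaging them in time and using that translations are continuous in
`L²` gives `sub_le_integral_inner_of_subgradient`.

The interpolation inequality, applied to constants, forces `k √(b - a) ≥ 1`, so the closeness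
assumption on `u₀` makes `|v - ζ|` pointwise less than `α / (1 + 2α)`, and this persists because
`X` cannot increase while it holds. Hence `X t + c ∫₀ᵗ X ≤ X 0` for all times, with `c > 0` and `X`
nonincreasing, and `X t → 0` (`tendsto_zero_of_conditional_decay`).
-/

namespace LandauLifshitz

noncomputable section

/-! ### A chain rule inequality for curves in a Hilbert space -/

section Energy

variable {H : Type*} [NormedAddCommGroup H] [InnerProductSpace ℝ H]

/-- Translation is continuous in `L²(ℝ; H)`, tested against a fixed `L²` function. -/
theorem continuous_integral_inner_translate {F w : ℝ → H} (hF : MemLp F 2) (hw : MemLp w 2) :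
    Continuous fun r : ℝ => ∫ t, inner ℝ (F (t - r)) (w t) := by
  have : Fact ((2 : ENNReal) ≠ ⊤) := ⟨by simp⟩
  have hmk : Continuous fun r : ℝ => DomAddAct.mk (-r) :=
    DomAddAct.continuous_mk.comp continuous_neg
  have hc : Continuous fun r : ℝ => inner ℝ (DomAddAct.mk (-r) +ᵥ hF.toLp F) (hw.toLp w) :=
    (hmk.vadd continuous_const).inner continuous_const
  convert hc using 2 with r
  rw [L2.inner_def]
  refine integral_congr_ae ?_
  have hm : MeasurePreserving (fun x : ℝ => -r + x) volume volume :=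
    measurePreserving_add_left volume (-r)
  filter_upwards [DomAddAct.vadd_Lp_ae_eq (DomAddAct.mk (-r)) (hF.toLp F), hw.coeFn_toLp,
    hm.quasiMeasurePreserving.ae_eq_comp hF.coeFn_toLp] with x h1 h2 h3
  rw [h1, h2]
  have h4 : (hF.toLp F : ℝ → H) (-r + x) = F (-r + x) := h3
  have h5 : x - r = -r + x := by ring
  rw [h5, ← h4]
  rfl

theorem integrable_inner_translate {F w : ℝ → H} (hF : MemLp F 2) (hw : MemLp w 2) (h : ℝ) :
    Integrable (fun p : ℝ × ℝ => inner ℝ (F (p.1 - p.2)) (w p.1))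
      ((volume : Measure ℝ).prod (volume.restrict (Ioc 0 h))) := by
  have hq : Measure.QuasiMeasurePreserving (fun p : ℝ × ℝ => p.1 - p.2)
      ((volume : Measure ℝ).prod (volume.restrict (Ioc 0 h))) volume :=
    (quasiMeasurePreserving_sub volume volume).mono_left
      (Measure.prod_mono le_rfl Measure.restrict_le_self |>.absolutelyContinuous)
  have hF2 : Integrable (fun x => ‖F x‖ ^ 2) volume :=
    (memLp_two_iff_integrable_sq_norm hF.1).1 hF
  have hw2 : Integrable (fun x => ‖w x‖ ^ 2) volume :=
    (memLp_two_iff_integrable_sq_norm hw.1).1 hw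
  have h1 : Integrable (fun _ : ℝ => (1 : ℝ)) (volume.restrict (Ioc 0 h)) := by
    simp
  have i1 := h1.convolution_integrand (ContinuousLinearMap.mul ℝ ℝ) hF2
  have i2 := hw2.mul_prod h1
  refine Integrable.mono' (i1.add i2) ?_ ?_
  · exact (hF.1.comp_quasiMeasurePreserving hq).inner hw.1.comp_fst
  · refine Eventually.of_forall fun p => ?_
    have := norm_inner_le_norm (𝕜 := ℝ) (F (p.1 - p.2)) (w p.1)
    simp only [Pi.add_apply, ContinuousLinearMap.mul_apply', one_mul, mul_one]
    nlinarith [sq_nonneg (‖F (p.1 - p.2)‖ - ‖w p.1‖), sq_nonneg (‖F (p.1 - p.2)‖),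
      sq_nonneg (‖w p.1‖)]

variable [CompleteSpace H]

theorem integral_inner_average {F w : ℝ → H} (hF : MemLp F 2) (hw : MemLp w 2) {h : ℝ}
    (hh : 0 ≤ h) :
    Integrable (fun t => inner ℝ (∫ r in (0 : ℝ)..h, F (t - r)) (w t)) ∧
    ∫ t, inner ℝ (∫ r in (0 : ℝ)..h, F (t - r)) (w t)
      = ∫ r in (0 : ℝ)..h, ∫ t, inner ℝ (F (t - r)) (w t) := by
  have hi := integrable_inner_translate hF hw h
  have key : ∀ t, inner ℝ (∫ r in (0 : ℝ)..h, F (t - r)) (w t)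
      = ∫ r in Ioc 0 h, inner ℝ (F (t - r)) (w t) := by
    intro t
    have hint : IntegrableOn (fun r => F (t - r)) (Ioc 0 h) := by
      have : MemLp (fun r => F (t - r)) 2 volume :=
        hF.comp_measurePreserving (Measure.measurePreserving_sub_left volume t)
      exact (this.restrict _).integrable one_le_two
    rw [intervalIntegral.integral_of_le hh, real_inner_comm, ← integral_inner hint (w t)]
    simp only [real_inner_comm]
  simp_rw [key]
  refine ⟨hi.integral_prod_left, ?_⟩
  rw [intervalIntegral.integral_of_le hh]
  exact integral_integral_swap hi

/-- The chain rule as an inequality. Think of `φ t` as the value of a convex functional on `H` along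
a curve with velocity `F`, and of `w t` as a subgradient of it. The functional need not be finite on
all of `H`, nor differentiable: only the backward difference quotients of `φ` enter. -/
theorem sub_le_integral_inner_of_subgradient {φ : ℝ → ℝ} {F w : ℝ → H} {s τ : ℝ} (hst : s < τ)
    (hφ : ContinuousOn φ (Icc s τ)) (hF : MemLp F 2 (volume.restrict (Ioo s τ)))
    (hw : MemLp w 2 (volume.restrict (Ioo s τ)))
    (hsub : ∀ᵐ t ∂volume.restrict (Ioo s τ), ∀ r ∈ Icc s t,
      φ t - φ r ≤ inner ℝ (∫ x in r..t, F x) (w t)) :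
    φ τ - φ s ≤ ∫ t in Ioo s τ, inner ℝ (F t) (w t) := by
  set F' : ℝ → H := (Ioo s τ).indicator F with hF'
  set w' : ℝ → H := (Ioo s τ).indicator w with hw'
  have mF : MemLp F' 2 := (memLp_indicator_iff_restrict measurableSet_Ioo).2 hF
  have mw : MemLp w' 2 := (memLp_indicator_iff_restrict measurableSet_Ioo).2 hw
  set ψ : ℝ → ℝ := IccExtend hst.le ((Icc s τ).domRestrict φ) with hψ
  have hψc : Continuous ψ := (continuousOn_iff_continuous_domRestrict.1 hφ).Icc_extend'
  have hψe : ∀ t ∈ Icc s τ, ψ t = φ t := fun t ht => by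
    rw [hψ, IccExtend_of_mem _ _ ht, domRestrict_apply]
  have hψs : ∀ t ≤ s, ψ t = φ s := fun t ht => by
    rw [hψ, IccExtend_of_le_left _ _ ht, domRestrict_apply]
  set c : ℝ → ℝ := fun r => ∫ t, inner ℝ (F' (t - r)) (w' t) with hc
  have hcc : Continuous c := continuous_integral_inner_translate mF mw
  have hii : ∀ x y : ℝ, IntervalIntegrable F' volume x y := fun x y =>
    ⟨(mF.restrict _).integrable one_le_two, (mF.restrict _).integrable one_le_two⟩
  have hψi : ∀ x y : ℝ, IntervalIntegrable ψ volume x y := fun x y => hψc.intervalIntegrable x y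
  -- the subgradient inequality between `t - h` and `t`, integrated over `t`; the integral of the
  -- difference `ψ t - ψ (t - h)` telescopes to two boundary layers of width `h`
  have step : ∀ h : ℝ, 0 < h →
      (∫ t in (τ - h)..τ, ψ t) - (∫ t in (s - h)..s, ψ t) ≤ ∫ r in (0 : ℝ)..h, c r := by
    intro h hh
    obtain ⟨hi, he⟩ := integral_inner_average mF mw hh.le
    have hle : ∀ᵐ t ∂volume.restrict (Ioo s τ),
        ψ t - ψ (t - h) ≤ inner ℝ (∫ r in (0 : ℝ)..h, F' (t - r)) (w' t) := by
      filter_upwards [hsub, ae_restrict_mem measurableSet_Ioo] with t ht htm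
      have hr : max (t - h) s ∈ Icc s t := ⟨le_max_right _ _, max_le (by linarith) htm.1.le⟩
      have h1 := ht _ hr
      have h2 : ψ (t - h) = φ (max (t - h) s) := by
        rcases le_total (t - h) s with h3 | h3
        · rw [hψs _ h3, max_eq_right h3]
        · rw [hψe _ ⟨h3, by linarith [htm.2]⟩, max_eq_left h3]
      have h4 : ∫ r in (0 : ℝ)..h, F' (t - r) = ∫ x in (max (t - h) s)..t, F x := by
        rw [intervalIntegral.integral_comp_sub_left (fun x => F' x) t, sub_zero,
          ← intervalIntegral.integral_add_adjacent_intervals (hii (t - h) (max (t - h) s))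
            (hii (max (t - h) s) t)]
        have e1 : ∫ x in (t - h)..(max (t - h) s), F' x = 0 := by
          rw [intervalIntegral.integral_of_le (le_max_left _ _)]
          refine setIntegral_eq_zero_of_forall_eq_zero fun x hx => ?_
          rw [hF', indicator_of_notMem]
          rintro ⟨hx1, -⟩
          rcases le_max_iff.1 hx.2 with h5 | h5
          · exact absurd hx.1 (not_lt.2 h5)
          · exact absurd hx1 (not_lt.2 h5)
        rw [e1, zero_add, intervalIntegral.integral_of_le hr.2,
          intervalIntegral.integral_of_le hr.2]
        refine setIntegral_congr_fun measurableSet_Ioc fun x hx => ?_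
        have hx' : x ∈ Ioo s τ := ⟨lt_of_le_of_lt hr.1 hx.1, lt_of_le_of_lt hx.2 htm.2⟩
        rw [hF', indicator_of_mem hx']
      rw [h4, h2, hψe t ⟨htm.1.le, htm.2.le⟩, hw', indicator_of_mem htm]
      exact h1
    have hψh : Continuous fun t => ψ (t - h) := hψc.comp (continuous_id.sub continuous_const)
    have hL : ∫ t in Ioo s τ, (ψ t - ψ (t - h))
        = (∫ t in (τ - h)..τ, ψ t) - (∫ t in (s - h)..s, ψ t) := by
      rw [← integral_Ioc_eq_integral_Ioo, ← intervalIntegral.integral_of_le hst.le,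
        intervalIntegral.integral_sub (hψi s τ) (hψh.intervalIntegrable s τ),
        intervalIntegral.integral_comp_sub_right (fun x => ψ x) h]
      have a1 := intervalIntegral.integral_add_adjacent_intervals (hψi (s - h) s) (hψi s τ)
      have a2 := intervalIntegral.integral_add_adjacent_intervals (hψi (s - h) (τ - h))
        (hψi (τ - h) τ)
      linarith
    have hR : ∫ t in Ioo s τ, inner ℝ (∫ r in (0 : ℝ)..h, F' (t - r)) (w' t)
        = ∫ r in (0 : ℝ)..h, c r := by
      rw [setIntegral_eq_integral_of_forall_compl_eq_zero, he]
      intro t ht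
      rw [hw', indicator_of_notMem ht, inner_zero_right]
    rw [← hL, ← hR]
    refine integral_mono_ae ?_ hi.integrableOn hle
    exact ((hψc.sub hψh).continuousOn.integrableOn_Icc).mono_set Ioo_subset_Icc_self
  have hc0 : c 0 = ∫ t in Ioo s τ, inner ℝ (F t) (w t) := by
    rw [hc, ← integral_indicator measurableSet_Ioo]
    refine integral_congr_ae (Eventually.of_forall fun t => ?_)
    by_cases ht : t ∈ Ioo s τ
    · simp [hF', hw', ht]
    · simp [hF', hw', ht]
  have dE : HasDerivAt (fun h => ∫ r in (0 : ℝ)..h, c r) (c 0) 0 :=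
    hcc.integral_hasStrictDerivAt 0 0 |>.hasDerivAt
  have dψ : ∀ x : ℝ, HasDerivAt (fun h => ∫ t in (x - h)..x, ψ t) (ψ x) 0 := by
    intro x
    have h1 : HasDerivAt (fun z => ∫ t in x..z, ψ t) (ψ (x - 0)) (x - 0) :=
      (hψc.integral_hasStrictDerivAt x (x - 0)).hasDerivAt
    have h2 := (h1.comp (0 : ℝ) ((hasDerivAt_id (0 : ℝ)).const_sub x)).neg
    simp only [sub_zero, mul_neg, mul_one, neg_neg] at h2
    refine h2.congr_of_eventuallyEq (Eventually.of_forall fun h => ?_)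
    simp only [Pi.neg_apply, Function.comp]
    rw [← intervalIntegral.integral_symm]
  -- both sides of `step` vanish at `h = 0`, so their right derivatives there are ordered
  have dD := (dψ τ).sub (dψ s)
  rw [← hc0, ← hψe τ ⟨hst.le, le_rfl⟩, ← hψe s ⟨le_rfl, hst.le⟩]
  have hsubset : Ioi (0 : ℝ) ⊆ {0}ᶜ := fun x hx => (mem_Ioi.1 hx).ne'
  have t1 := (hasDerivAt_iff_tendsto_slope.1 dD).mono_left
    (nhdsWithin_mono 0 hsubset)
  have t2 := (hasDerivAt_iff_tendsto_slope.1 dE).mono_left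
    (nhdsWithin_mono 0 hsubset)
  refine le_of_tendsto_of_tendsto t1 t2 ?_
  filter_upwards [self_mem_nhdsWithin] with h hh
  have hh' : 0 < h := hh
  have := step h hh'
  simp only [slope, vsub_eq_sub, sub_zero, smul_eq_mul, Pi.sub_apply,
    intervalIntegral.integral_same]
  gcongr

end Energy

/-! ### Weak derivatives and absolutely continuous representatives -/

/-- A test function of integral zero is the derivative of a test function. -/
theorem exists_primitive_of_integral_eq_zero {a b : ℝ} {θ : ℝ → ℝ}
    (hθ : ContDiff ℝ ((⊤ : ℕ∞) : WithTop ℕ∞) θ) (hc : HasCompactSupport θ)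
    (hs : tsupport θ ⊆ Ioo a b) (h0 : ∫ x, θ x = 0) :
    ∃ φ : ℝ → ℝ, ContDiff ℝ ((⊤ : ℕ∞) : WithTop ℕ∞) φ ∧ HasCompactSupport φ ∧
      tsupport φ ⊆ Ioo a b ∧ deriv φ = θ := by
  rcases (tsupport θ).eq_empty_or_nonempty with he | hne
  · have hz : θ = 0 := tsupport_eq_empty_iff.1 he
    exact ⟨0, contDiff_const, HasCompactSupport.zero, by simp [tsupport], by
      rw [hz]; funext x; simp⟩
  obtain ⟨m, hm⟩ := hc.isCompact.exists_isLeast hne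
  obtain ⟨M, hM⟩ := hc.isCompact.exists_isGreatest hne
  have hz : ∀ x, x ∉ Icc m M → θ x = 0 := fun x hx =>
    image_eq_zero_of_notMem_tsupport fun h => hx ⟨hm.2 h, hM.2 h⟩
  have hd : ∀ x, HasDerivAt (fun x => ∫ t in m..x, θ t) (θ x) x := fun x =>
    (hθ.continuous.integral_hasStrictDerivAt m x).hasDerivAt
  have hsub : Function.support (fun x => ∫ t in m..x, θ t) ⊆ Icc m M := by
    intro x hx
    by_contra hxn
    refine hx ?_
    rcases lt_or_ge x m with h1 | h1
    · refine intervalIntegral.integral_zero_ae ?_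
      have : ∀ᵐ t : ℝ, t ≠ m := by simp [ae_iff, measure_singleton]
      filter_upwards [this] with t ht1 ht2
      rw [uIoc_of_ge h1.le] at ht2
      exact hz t fun h => ht1 (le_antisymm ht2.2 h.1)
    · have h2 : M < x := not_le.1 fun h => hxn ⟨h1, h⟩
      have h3 : ∫ t in m..x, θ t = ∫ t, θ t := by
        rw [intervalIntegral.integral_of_le h1, ← integral_Icc_eq_integral_Ioc]
        exact setIntegral_eq_integral_of_forall_compl_eq_zero fun t ht =>
          hz t fun h => ht ⟨h.1, h.2.trans h2.le⟩
      exact h3.trans h0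
  have hts : tsupport (fun x => ∫ t in m..x, θ t) ⊆ Icc m M :=
    closure_minimal hsub isClosed_Icc
  have hderiv : deriv (fun x => ∫ t in m..x, θ t) = θ := funext fun x => (hd x).deriv
  refine ⟨fun x => ∫ t in m..x, θ t, ?_, HasCompactSupport.of_support_subset_isCompact
    isCompact_Icc hsub, hts.trans ?_, hderiv⟩
  · rw [contDiff_infty_iff_deriv]
    exact ⟨fun x => (hd x).differentiableAt, by rw [hderiv]; exact hθ⟩
  · exact Icc_subset_Ioo (hs hm.1).1 (hs hM.1).2

/-- The du Bois-Reymond lemma: only constants have vanishing weak derivative. -/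
theorem exists_ae_eq_const_of_integral_deriv_mul_eq_zero {a b : ℝ} (hab : a < b) {f : ℝ → ℝ}
    (hf : IntegrableOn f (Ioo a b))
    (h : ∀ φ : ℝ → ℝ, ContDiff ℝ ((⊤ : ℕ∞) : WithTop ℕ∞) φ → HasCompactSupport φ →
      tsupport φ ⊆ Ioo a b → ∫ x in Ioo a b, deriv φ x * f x = 0) :
    ∃ c : ℝ, ∀ᵐ x ∂volume.restrict (Ioo a b), f x = c := by
  let B : ContDiffBump ((a + b) / 2) := ⟨(b - a) / 8, (b - a) / 4, by linarith, by linarith⟩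
  set ρ : ℝ → ℝ := B.normed volume with hρ
  have hρs : ContDiff ℝ ((⊤ : ℕ∞) : WithTop ℕ∞) ρ := B.contDiff_normed
  have hρc : HasCompactSupport ρ := B.hasCompactSupport_normed
  have hρt : tsupport ρ ⊆ Ioo a b := by
    rw [hρ, B.tsupport_normed_eq, Real.closedBall_eq_Icc]
    have : B.rOut = (b - a) / 4 := rfl
    rw [this]
    exact Icc_subset_Ioo (by linarith) (by linarith)
  have hρi : ∫ x, ρ x = 1 := B.integral_normed
  have hmul : ∀ ψ : ℝ → ℝ, Continuous ψ → HasCompactSupport ψ →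
      IntegrableOn (fun x => ψ x * f x) (Ioo a b) := by
    intro ψ hψ hs
    obtain ⟨C, hC⟩ := hψ.bounded_above_of_compact_support hs
    exact hf.bdd_mul hψ.aestronglyMeasurable (Eventually.of_forall hC)
  set c : ℝ := ∫ x in Ioo a b, ρ x * f x with hcdef
  refine ⟨c, ?_⟩
  have key : ∀ᵐ x, x ∈ Ioo a b → f x - c = 0 := by
    refine isOpen_Ioo.ae_eq_zero_of_integral_contDiff_smul_eq_zero ?_ ?_
    · exact (hf.sub (by simp)).locallyIntegrableOn
    · intro ψ hψ hψc hψs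
      -- `ψ` minus its integral times the bump `ρ` is the derivative of a test function
      set m : ℝ := ∫ x, ψ x with hm
      have hts : tsupport (fun x => ψ x - m * ρ x) ⊆ Ioo a b := by
        refine (tsupport_sub ψ (fun x => m * ρ x)).trans (union_subset hψs ?_)
        exact (tsupport_mul_subset_right (f := fun _ => m) (g := ρ)).trans hρt
      have hcs : HasCompactSupport (fun x => ψ x - m * ρ x) :=
        hψc.sub (hρc.mul_left (f := fun _ => m))
      have hint : ∫ x, (ψ x - m * ρ x) = 0 := by
        rw [integral_sub (hψ.continuous.integrable_of_hasCompactSupport hψc)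
          ((hρs.continuous.integrable_of_hasCompactSupport hρc).const_mul m),
          integral_const_mul, hρi, mul_one, ← hm, sub_self]
      obtain ⟨φ, h1, h2, h3, h4⟩ := exists_primitive_of_integral_eq_zero
        (hψ.sub (contDiff_const.mul hρs)) hcs hts hint
      have h5 := h φ h1 h2 h3
      rw [h4] at h5
      have h6 : ∫ x in Ioo a b, (ψ x - m * ρ x) * f x
          = (∫ x in Ioo a b, ψ x * f x) - m * c := by
        rw [hcdef, ← integral_const_mul, ← integral_sub (hmul ψ hψ.continuous hψc)
          ((hmul ρ hρs.continuous hρc).const_mul m)]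
        refine integral_congr_ae (Eventually.of_forall fun x => ?_)
        simp only
        ring
      have h7 : ∫ x in Ioo a b, ψ x = m := setIntegral_eq_integral_of_forall_compl_eq_zero
        fun x hx => image_eq_zero_of_notMem_tsupport fun h => hx (hψs h)
      rw [← setIntegral_eq_integral_of_forall_compl_eq_zero (s := Ioo a b)]
      · simp only [smul_eq_mul, mul_sub]
        rw [integral_sub (hmul ψ hψ.continuous hψc)
          ((hψ.continuous.integrable_of_hasCompactSupport hψc).mul_const c).integrableOn,
          integral_mul_const, h7]
        linarith
      · intro x hx
        rw [image_eq_zero_of_notMem_tsupport fun h => hx (hψs h), zero_smul]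
  rw [ae_restrict_iff' measurableSet_Ioo]
  filter_upwards [key] with x hx hxm
  linarith [hx hxm]

theorem ae_deriv_primitive {a b : ℝ} (hab : a < b) {g : ℝ → ℝ} (hg : IntegrableOn g (Ioo a b)) :
    IntervalIntegrable g volume a b ∧
    AbsolutelyContinuousOnInterval (fun x => ∫ t in a..x, g t) a b ∧
    ∀ᵐ x ∂volume.restrict (Ioo a b), HasDerivAt (fun x => ∫ t in a..x, g t) (g x) x := by
  have hi : IntervalIntegrable g volume a b := by
    rw [intervalIntegrable_iff_integrableOn_Ioc_of_le hab.le, integrableOn_Ioc_iff_integrableOn_Ioo]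
    exact hg
  refine ⟨hi, hi.absolutelyContinuousOnInterval_intervalIntegral left_mem_uIcc, ?_⟩
  rw [ae_restrict_iff' measurableSet_Ioo]
  filter_upwards [hi.ae_hasDerivAt_integral] with x hx hxm
  exact hx (by rw [uIcc_of_le hab.le]; exact Ioo_subset_Icc_self hxm) a left_mem_uIcc

/-- A function with an integrable weak derivative has an absolutely continuous representative,
namely a primitive of the weak derivative. -/
theorem exists_ae_eq_primitive {a b : ℝ} (hab : a < b) {f g : ℝ → ℝ}
    (hf : IntegrableOn f (Ioo a b)) (hg : IntegrableOn g (Ioo a b))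
    (h : ∀ φ : ℝ → ℝ, ContDiff ℝ ((⊤ : ℕ∞) : WithTop ℕ∞) φ → HasCompactSupport φ →
      tsupport φ ⊆ Ioo a b →
        ∫ x in Ioo a b, deriv φ x * f x = - ∫ x in Ioo a b, φ x * g x) :
    ∃ V : ℝ → ℝ, AbsolutelyContinuousOnInterval V a b ∧
      ∀ᵐ x ∂volume.restrict (Ioo a b), f x = V x ∧ HasDerivAt V (g x) x := by
  obtain ⟨hi, hG, hd⟩ := ae_deriv_primitive hab hg
  set G : ℝ → ℝ := fun x => ∫ t in a..x, g t with hGdef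
  have hGi : IntegrableOn G (Ioo a b) := by
    have := hG.continuousOn
    rw [uIcc_of_le hab.le] at this
    exact this.integrableOn_Icc.mono_set Ioo_subset_Icc_self
  have hbdd : ∀ (ψ u : ℝ → ℝ), Continuous ψ → HasCompactSupport ψ → IntegrableOn u (Ioo a b) →
      IntegrableOn (fun x => ψ x * u x) (Ioo a b) := by
    intro ψ u hψ hs hu
    obtain ⟨C, hC⟩ := hψ.bounded_above_of_compact_support hs
    exact hu.bdd_mul hψ.aestronglyMeasurable (Eventually.of_forall hC)
  have hparts : ∀ φ : ℝ → ℝ, ContDiff ℝ ((⊤ : ℕ∞) : WithTop ℕ∞) φ → tsupport φ ⊆ Ioo a b →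
      ∫ x in Ioo a b, deriv φ x * G x = - ∫ x in Ioo a b, φ x * g x := by
    intro φ h1 h3
    have hac : AbsolutelyContinuousOnInterval φ a b :=
      (h1.of_le (by simp)).contDiffOn.absolutelyContinuousOnInterval
    have e := hac.integral_mul_deriv_eq_deriv_mul hG
    have ea : φ a = 0 := image_eq_zero_of_notMem_tsupport fun h => (h3 h).1.false
    have eb : φ b = 0 := image_eq_zero_of_notMem_tsupport fun h => (h3 h).2.false
    rw [ea, eb, intervalIntegral.integral_of_le hab.le, intervalIntegral.integral_of_le hab.le,
      integral_Ioc_eq_integral_Ioo, integral_Ioc_eq_integral_Ioo] at e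
    have e2 : ∫ x in Ioo a b, φ x * deriv G x = ∫ x in Ioo a b, φ x * g x := by
      refine integral_congr_ae ?_
      filter_upwards [hd] with x hx
      rw [hx.deriv]
    linarith
  obtain ⟨c, hc⟩ := exists_ae_eq_const_of_integral_deriv_mul_eq_zero hab (hf.sub hGi) (by
    intro φ h1 h2 h3
    have hdc : Continuous (deriv φ) := h1.continuous_deriv (by simp)
    have e : ∫ x in Ioo a b, deriv φ x * (f - G) x
        = (∫ x in Ioo a b, deriv φ x * f x) - ∫ x in Ioo a b, deriv φ x * G x := by
      rw [← integral_sub (hbdd _ f hdc h2.deriv hf) (hbdd _ G hdc h2.deriv hGi)]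
      simp only [Pi.sub_apply, mul_sub]
    rw [e, h φ h1 h2 h3, hparts φ h1 h3, sub_self])
  have hcont : AbsolutelyContinuousOnInterval (fun _ : ℝ => c) a b :=
    (contDiff_const (c := c)).contDiffOn.absolutelyContinuousOnInterval
  refine ⟨fun x => c + G x, hcont.fun_add hG, ?_⟩
  filter_upwards [hc, hd] with x h1 h2
  refine ⟨?_, h2.const_add c⟩
  simp only [Pi.sub_apply] at h1
  linarith

theorem memLp_component {a b : ℝ} (u : L2 a b) (i : Fin 3) :
    MemLp (fun x => u x i) 2 (volume.restrict (Ioo a b)) :=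
  (EuclideanSpace.proj i : R3 →L[ℝ] ℝ).comp_memLp' (Lp.memLp u)

theorem integrable_component {a b : ℝ} (u : L2 a b) (i : Fin 3) :
    IntegrableOn (fun x => u x i) (Ioo a b) :=
  (memLp_component u i).integrable one_le_two

theorem IsWeakDeriv.exists_primitive {a b : ℝ} (hab : a < b) {u g : L2 a b}
    (h : IsWeakDeriv u g) (i : Fin 3) :
    ∃ V : ℝ → ℝ, AbsolutelyContinuousOnInterval V a b ∧
      ∀ᵐ x ∂volume.restrict (Ioo a b), u x i = V x ∧ HasDerivAt V (g x i) x := by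
  refine exists_ae_eq_primitive hab (integrable_component u i) (integrable_component g i) ?_
  intro φ h1 h2 h3
  have hproj : ∀ (ψ : ℝ → ℝ) (f : L2 a b), Continuous ψ → HasCompactSupport ψ →
      ∫ x in Ioo a b, ψ x * f x i = (∫ x in Ioo a b, ψ x • f x) i := by
    intro ψ f hψ hs
    have := (EuclideanSpace.proj i : R3 →L[ℝ] ℝ).integral_comp_comm
      (integrable_smul_L2 hψ hs f)
    simpa using this
  rw [hproj _ u (h1.continuous_deriv (by simp)) h2.deriv, hproj _ g h1.continuous h2,
    h φ h1 h2 h3]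
  simp

/-- For `u` with Neumann Laplacian `q`, the weak derivative has an absolutely continuous
representative that vanishes at both endpoints. -/
theorem IsNeumannLaplacian.exists_primitive {a b : ℝ} (hab : a < b) {u : H1 a b} {q : L2 a b}
    (h : IsNeumannLaplacian u q) (i : Fin 3) :
    ∃ P : ℝ → ℝ, AbsolutelyContinuousOnInterval P a b ∧ P a = 0 ∧ P b = 0 ∧
      ∀ᵐ x ∂volume.restrict (Ioo a b), weakD u x i = P x ∧ HasDerivAt P (q x i) x := by
  obtain ⟨hw, g, hgc, hge, ha, hb⟩ := h
  obtain ⟨P, hP, hPe⟩ := hw.exists_primitive hab i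
  have hPc := hP.continuousOn
  rw [uIcc_of_le hab.le] at hPc
  have hgi : ContinuousOn (fun x => g x i) (Icc a b) :=
    (EuclideanSpace.proj i : R3 →L[ℝ] ℝ).continuous.comp_continuousOn hgc
  have hae : P =ᵐ[volume.restrict (Icc a b)] fun x => g x i := by
    rw [← restrict_Ioo_eq_restrict_Icc]
    filter_upwards [hge, hPe] with x h1 h2
    rw [← h2.1, h1]
  have heq : EqOn P (fun x => g x i) (Icc a b) :=
    Measure.eqOn_Icc_of_ae_eq volume hab.ne hae hPc hgi
  refine ⟨P, hP, ?_, ?_, hPe⟩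
  · rw [heq (left_mem_Icc.2 hab.le)]; simp [ha]
  · rw [heq (right_mem_Icc.2 hab.le)]; simp [hb]

theorem integral_eq_zero_of_primitive {a b : ℝ} (hab : a < b) {B D : ℝ → ℝ}
    (hB : AbsolutelyContinuousOnInterval B a b) (ha : B a = 0) (hb : B b = 0)
    (hD : ∀ᵐ x ∂volume.restrict (Ioo a b), HasDerivAt B (D x) x) :
    IntegrableOn D (Ioo a b) ∧ ∫ x in Ioo a b, D x = 0 := by
  have hi := hB.intervalIntegrable_deriv
  rw [intervalIntegrable_iff_integrableOn_Ioc_of_le hab.le,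
    integrableOn_Ioc_iff_integrableOn_Ioo] at hi
  have he : deriv B =ᵐ[volume.restrict (Ioo a b)] D := by
    filter_upwards [hD] with x hx using hx.deriv
  refine ⟨hi.congr_fun_ae he, ?_⟩
  have h := hB.integral_deriv_eq_sub
  rw [intervalIntegral.integral_of_le hab.le, integral_Ioc_eq_integral_Ioo, ha, hb, sub_self,
    integral_congr_ae he] at h
  exact h

theorem inner_eq_sum (v w : R3) : inner ℝ v w = v 0 * w 0 + v 1 * w 1 + v 2 * w 2 := by
  simp only [PiLp.inner_apply, Fin.sum_univ_three, RCLike.inner_apply, conj_trivial]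
  ring

/-- Green's formula for the Neumann Laplacian. -/
theorem IsNeumannLaplacian.inner_eq_neg {a b : ℝ} (hab : a < b) {u : H1 a b} {q : L2 a b}
    (h : IsNeumannLaplacian u q) (v : H1 a b) :
    inner ℝ (val v) q = - inner ℝ (weakD v) (weakD u) := by
  have hv : IsWeakDeriv (val v) (weakD v) := v.2
  choose V hV hVe using fun i => hv.exists_primitive hab i
  choose P hP hPa hPb hPe using fun i => h.exists_primitive hab i
  have hB : AbsolutelyContinuousOnInterval (fun x => V 0 x * P 0 x + V 1 x * P 1 x + V 2 x * P 2 x)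
      a b := (((hV 0).fun_mul (hP 0)).fun_add ((hV 1).fun_mul (hP 1))).fun_add
        ((hV 2).fun_mul (hP 2))
  obtain ⟨-, hz⟩ := integral_eq_zero_of_primitive hab hB
    (D := fun x => inner ℝ (val v x) (q x) + inner ℝ (weakD v x) (weakD u x))
    (by simp [hPa]) (by simp [hPb]) (by
      filter_upwards [ae_all_iff.2 hVe, ae_all_iff.2 hPe] with x h1 h2
      refine ((((h1 0).2.mul (h2 0).2).add ((h1 1).2.mul (h2 1).2)).add
        ((h1 2).2.mul (h2 2).2)).congr_deriv ?_
      rw [inner_eq_sum, inner_eq_sum, (h1 0).1, (h1 1).1, (h1 2).1, (h2 0).1, (h2 1).1, (h2 2).1]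
      ring)
  rw [integral_add (L2.integrable_inner (𝕜 := ℝ) _ _) (L2.integrable_inner (𝕜 := ℝ) _ _)] at hz
  rw [L2.inner_def, L2.inner_def]
  linarith

/-! ### Conservation of length -/

theorem absolutelyContinuousOnInterval_of_dist_le {X Y : Type*} [PseudoMetricSpace X]
    [PseudoMetricSpace Y] {f : ℝ → X} {g : ℝ → Y} {a b : ℝ}
    (hg : AbsolutelyContinuousOnInterval g a b)
    (h : ∀ s ∈ uIcc a b, ∀ t ∈ uIcc a b, dist (f s) (f t) ≤ dist (g s) (g t)) :
    AbsolutelyContinuousOnInterval f a b := by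
  rw [absolutelyContinuousOnInterval_iff] at hg ⊢
  intro ε hε
  obtain ⟨δ, hδ, hE⟩ := hg ε hε
  refine ⟨δ, hδ, fun E hEd hEl => lt_of_le_of_lt (Finset.sum_le_sum fun i hi => ?_) (hE E hEd hEl)⟩
  exact h _ (hEd.1 i hi).1 _ (hEd.1 i hi).2

/-- The norm of an absolutely continuous curve in a Hilbert space is conserved when the velocity
is orthogonal to the position. -/
theorem norm_add_integral_eq_of_inner_eq_zero {H : Type*} [NormedAddCommGroup H]
    [InnerProductSpace ℝ H] [CompleteSpace H] {G : ℝ → H} {z₀ : H} {T : ℝ} (hT : 0 ≤ T)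
    (hG : IntervalIntegrable G volume 0 T)
    (h : ∀ᵐ t ∂volume.restrict (Ioi (0 : ℝ)), t ≤ T →
      inner ℝ (z₀ + ∫ s in (0 : ℝ)..t, G s) (G t) = 0) :
    ‖z₀ + ∫ s in (0 : ℝ)..T, G s‖ = ‖z₀‖ := by
  set z : ℝ → H := fun t => z₀ + ∫ s in (0 : ℝ)..t, G s with hz
  have hN := hG.norm.absolutelyContinuousOnInterval_intervalIntegral (c := 0) left_mem_uIcc
  have hsub : ∀ s ∈ uIcc 0 T, ∀ t ∈ uIcc 0 T, IntervalIntegrable G volume s t :=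
    fun s hs t ht => hG.mono_set (uIcc_subset_uIcc hs ht)
  have hac : AbsolutelyContinuousOnInterval (fun t => ‖z t‖) 0 T := by
    refine absolutelyContinuousOnInterval_of_dist_le hN fun s hs t ht => ?_
    have h1 : z s - z t = ∫ x in t..s, G x := by
      simp only [hz, add_sub_add_left_eq_sub]
      exact intervalIntegral.integral_interval_sub_left (hsub 0 left_mem_uIcc s hs)
        (hsub 0 left_mem_uIcc t ht)
    have h2 : (∫ v in (0 : ℝ)..s, ‖G v‖) - ∫ v in (0 : ℝ)..t, ‖G v‖ = ∫ v in t..s, ‖G v‖ :=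
      intervalIntegral.integral_interval_sub_left (hsub 0 left_mem_uIcc s hs).norm
        (hsub 0 left_mem_uIcc t ht).norm
    rw [Real.dist_eq, Real.dist_eq, h2]
    refine (abs_norm_sub_norm_le _ _).trans ?_
    rw [h1]
    exact intervalIntegral.norm_integral_le_abs_integral_norm
  have h0 : ∀ᵐ t : ℝ, t ≠ 0 := by simp [ae_iff, measure_singleton]
  obtain ⟨C, hC⟩ := (hac.fun_mul hac).const_of_ae_hasDerivAt_zero (by
    rw [ae_restrict_iff' measurableSet_Ioi] at h
    filter_upwards [hG.ae_hasDerivAt_integral, h, h0] with t h1 h2 h3 ht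
    have hd : HasDerivAt z (G t) t := (h1 ht 0 left_mem_uIcc).const_add z₀
    have hsq := hd.norm_sq
    rw [uIcc_of_le hT] at ht
    rw [h2 (lt_of_le_of_ne ht.1 h3.symm) ht.2, mul_zero] at hsq
    simpa only [pow_two] using hsq)
  have e := (hC T right_mem_uIcc).trans (hC 0 left_mem_uIcc).symm
  have e0 : z 0 = z₀ := by simp [hz]
  rw [e0] at e
  exact (mul_self_inj (norm_nonneg _) (norm_nonneg _)).1 e

theorem inner_llRHS_self (α β : ℝ) (K v w : R3) : inner ℝ v (llRHS α β K v w) = 0 := by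
  rw [inner_eq_sum]
  simp only [llRHS, cross, crossProduct, LinearMap.mk₂_apply, PiLp.sub_apply, PiLp.smul_apply,
    PiLp.add_apply, smul_eq_mul, Matrix.cons_val_zero, Matrix.cons_val_one, Matrix.cons_val]
  ring

theorem integral_inner_restrict {a b : ℝ} (f g : L2 a b) (S : Set ℝ) :
    inner ℝ (LpToLpRestrictCLM ℝ R3 ℝ (volume.restrict (Ioo a b)) 2 S f)
      (LpToLpRestrictCLM ℝ R3 ℝ (volume.restrict (Ioo a b)) 2 S g)
      = ∫ x in S, inner ℝ (f x) (g x) ∂volume.restrict (Ioo a b) := by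
  rw [L2.inner_def]
  refine integral_congr_ae ?_
  filter_upwards [LpToLpRestrictCLM_coeFn ℝ S f, LpToLpRestrictCLM_coeFn ℝ S g] with x h1 h2
  rw [h1, h2]

/-- The Landau–Lifshitz flow keeps the magnetization on the sphere: the right-hand side is
pointwise orthogonal to it, so that the integral of its squared length over any measurable set is
conserved. -/
theorem ae_norm_eq_one {a b : ℝ} {α β : ℝ} {u₀ : L2 a b}
    (hu₀ : ∀ᵐ x ∂volume.restrict (Ioo a b), ‖u₀ x‖ = 1) {v q F : ℝ → L2 a b}
    (hF : ∀ᵐ t ∂(volume.restrict (Ioi (0 : ℝ))),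
      F t =ᵐ[volume.restrict (Ioo a b)] fun x => llRHS α β 0 (v t x) (q t x))
    (hv : ∀ t : ℝ, 0 ≤ t → IntervalIntegrable F volume 0 t ∧ v t = u₀ + ∫ s in (0 : ℝ)..t, F s)
    {t : ℝ} (ht : 0 ≤ t) : ∀ᵐ x ∂volume.restrict (Ioo a b), ‖v t x‖ = 1 := by
  have key : ∀ S : Set ℝ,
      ∫ x in S, inner ℝ (v t x) (v t x) ∂volume.restrict (Ioo a b)
        = ∫ x in S, inner ℝ (u₀ x) (u₀ x) ∂volume.restrict (Ioo a b) := by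
    intro S
    set R := LpToLpRestrictCLM ℝ R3 ℝ (volume.restrict (Ioo a b)) 2 S with hR
    have hRi : ∀ r : ℝ, 0 ≤ r → R (v r) = R u₀ + ∫ s in (0 : ℝ)..r, R (F s) := by
      intro r hr
      rw [(hv r hr).2, map_add, R.intervalIntegral_comp_comm (hv r hr).1]
    have hi : IntervalIntegrable (fun s => R (F s)) volume 0 t :=
      ⟨R.integrable_comp (hv t ht).1.1, R.integrable_comp (hv t ht).1.2⟩
    have hn := norm_add_integral_eq_of_inner_eq_zero (z₀ := R u₀) ht hi (by
      filter_upwards [hF, ae_restrict_mem measurableSet_Ioi] with r hr hr0 _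
      rw [← hRi r (le_of_lt hr0), hR, integral_inner_restrict]
      refine integral_eq_zero_of_ae (ae_restrict_of_ae ?_)
      filter_upwards [hr] with x hx
      rw [hx, inner_llRHS_self]
      rfl)
    rw [← hRi t ht] at hn
    rw [← integral_inner_restrict, ← integral_inner_restrict, real_inner_self_eq_norm_sq,
      real_inner_self_eq_norm_sq, ← hR, hn]
  have hae := Integrable.ae_eq_of_forall_setIntegral_eq _ _ (L2.integrable_inner (𝕜 := ℝ) (v t) (v t))
    (L2.integrable_inner (𝕜 := ℝ) u₀ u₀) fun S _ _ => key S
  filter_upwards [hae, hu₀] with x h1 h2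
  rw [real_inner_self_eq_norm_sq, real_inner_self_eq_norm_sq, h2] at h1
  have h3 := norm_nonneg (v t x)
  nlinarith

/-! ### Energy balance at a fixed time -/

theorem norm_sq_eq_sum (v : R3) : ‖v‖ ^ 2 = v 0 ^ 2 + v 1 ^ 2 + v 2 ^ 2 := by
  rw [← real_inner_self_eq_norm_sq, inner_eq_sum]
  ring

/-- The lower-order terms of the energy balance at a point. Here `v` is a unit vector, `p` is
tangent to the sphere at `v`, and `E` is the squared distance from `v` to the pole `(σ, 0, 0)`.
The precession term `v₁p₂ - v₂p₁` and the anisotropy are controlled by the damping when `E` is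
small compared with `α`. -/
theorem lower_order_le {α β σ E v0 v1 v2 p0 p1 p2 : ℝ} (hα : 0 < α) (hβ : 0 < β)
    (hσ : σ ^ 2 = 1) (hv : v0 ^ 2 + v1 ^ 2 + v2 ^ 2 = 1)
    (hvp : v0 * p0 + v1 * p1 + v2 * p2 = 0)
    (hE : E = (v0 - σ) ^ 2 + v1 ^ 2 + v2 ^ 2) (hE1 : E ≤ 1) (hEα : E * (1 + 2 * α) ≤ α) :
    -β * (p0 * (v1 * p2 - v2 * p1)) - α * β * (p1 ^ 2 + p2 ^ 2)
      + α * β * (p0 ^ 2 + p1 ^ 2 + p2 ^ 2) * (v1 ^ 2 + v2 ^ 2)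
      - α * (σ * v0) * (p0 ^ 2 + p1 ^ 2 + p2 ^ 2 + β * (v1 ^ 2 + v2 ^ 2))
      ≤ -(α / 2) * (p0 ^ 2 + p1 ^ 2 + p2 ^ 2) - α * β / 4 * E := by
  set P : ℝ := p0 ^ 2 + p1 ^ 2 + p2 ^ 2 with hP
  set f : ℝ := v1 ^ 2 + v2 ^ 2 with hf
  have hP0 : 0 ≤ P := by positivity
  have hf0 : 0 ≤ f := by positivity
  have hE0 : 0 ≤ E := by rw [hE]; positivity
  have hfE : f ≤ E := by rw [hE, hf]; nlinarith [sq_nonneg (v0 - σ)]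
  have hg : σ * v0 = 1 - E / 2 := by rw [hE]; nlinarith
  -- `σ p₀ = (ζ - v) · p` because `p` is tangent at `v`; then Cauchy–Schwarz
  have hp0 : p0 ^ 2 ≤ E * P := by
    have e : p0 ^ 2 = ((v0 - σ) * p0 + v1 * p1 + v2 * p2) ^ 2 := by
      have : (v0 - σ) * p0 + v1 * p1 + v2 * p2 = -(σ * p0) := by linarith
      rw [this, neg_sq, mul_pow, hσ, one_mul]
    rw [e, hE, hP]
    nlinarith [sq_nonneg ((v0 - σ) * p1 - v1 * p0), sq_nonneg ((v0 - σ) * p2 - v2 * p0),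
      sq_nonneg (v1 * p2 - v2 * p1)]
  have hd : (v1 * p2 - v2 * p1) ^ 2 ≤ E * P := by
    have h1 : (v1 * p2 - v2 * p1) ^ 2 ≤ f * P := by
      rw [hf, hP]
      nlinarith [sq_nonneg (v1 * p1 + v2 * p2), mul_nonneg hf0 (sq_nonneg p0)]
    exact h1.trans (mul_le_mul_of_nonneg_right hfE hP0)
  have h1 : -(p0 * (v1 * p2 - v2 * p1)) ≤ E * P := by
    nlinarith [sq_nonneg (p0 + (v1 * p2 - v2 * p1))]
  have h2 : p1 ^ 2 + p2 ^ 2 = P - p0 ^ 2 := by rw [hP]; ring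
  have h3 : P * f ≤ E * P := by nlinarith
  have hff : E / 2 ≤ f := by
    have : f = (1 - σ * v0) * (1 + σ * v0) := by rw [hf]; linear_combination hv + v0 ^ 2 * hσ
    rw [this, hg]
    nlinarith
  have k1 : β * (-(p0 * (v1 * p2 - v2 * p1))) ≤ β * (E * P) := mul_le_mul_of_nonneg_left h1 hβ.le
  have hαβ : 0 < α * β := mul_pos hα hβ
  have k2 : α * β * p0 ^ 2 ≤ α * β * (E * P) := mul_le_mul_of_nonneg_left hp0 hαβ.le
  have k3 : α * β * (P * f) ≤ α * β * (E * P) := mul_le_mul_of_nonneg_left h3 hαβ.le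
  have k4 : β * P * (E * (1 + 2 * α)) ≤ β * P * α :=
    mul_le_mul_of_nonneg_left hEα (mul_nonneg hβ.le hP0)
  have hg2 : 1 / 2 ≤ σ * v0 := by linarith
  have k5 : α * (1 / 2) * (P + β * f) ≤ α * (σ * v0) * (P + β * f) := by
    have : 0 ≤ P + β * f := by positivity
    gcongr
  have k6 : α * β * (E / 2) ≤ α * β * f := mul_le_mul_of_nonneg_left hff hαβ.le
  rw [h2]
  linarith

/-- The vector field `Z = β v × f + α β f - ζ × v - α ζ`, where `f = (0, v₁, v₂)` and
`ζ = (σ, 0, 0)`. It collects all the terms of the energy balance that are linear in `Δv`. -/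
def multiplier (α β σ : ℝ) (v : Fin 3 → ℝ) : Fin 3 → ℝ :=
  ![-(α * σ), -(β * (v 0 * v 2)) + α * β * v 1 + σ * v 2,
    β * (v 0 * v 1) + α * β * v 2 - σ * v 1]

/-- The derivative of `multiplier α β σ` at `v` in the direction `p`. -/
def multiplierDeriv (α β σ : ℝ) (v p : Fin 3 → ℝ) : Fin 3 → ℝ :=
  ![0, -(β * (p 0 * v 2 + v 0 * p 2)) + α * β * p 1 + σ * p 2,
    β * (p 0 * v 1 + v 0 * p 1) + α * β * p 2 - σ * p 1]

/-- The energy balance at a point: up to the divergence-form term, the Landau–Lifshitz right-hand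
side tested with the subgradient `2 (v - ζ) - 2 Δv` dissipates. Here `p` and `q` stand for the
first and second spatial derivatives of `v`, and `hvp`, `hvq` come from differentiating `|v|² = 1`
twice. -/
theorem inner_llRHS_le {α β σ : ℝ} (hα : 0 < α) (hβ : 0 < β) (hσ : σ ^ 2 = 1) {v p q : R3}
    (hv : ‖v‖ = 1) (hvp : v 0 * p 0 + v 1 * p 1 + v 2 * p 2 = 0)
    (hvq : v 0 * q 0 + v 1 * q 1 + v 2 * q 2 = -(p 0 ^ 2 + p 1 ^ 2 + p 2 ^ 2))
    (hE1 : ‖v - !₂[σ, 0, 0]‖ ^ 2 ≤ 1) (hEα : ‖v - !₂[σ, 0, 0]‖ ^ 2 * (1 + 2 * α) ≤ α) :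
    inner ℝ (llRHS α β 0 v q) ((2 : ℝ) • (v - !₂[σ, 0, 0]) - (2 : ℝ) • q)
      ≤ 2 * ∑ i, (q i * multiplier α β σ v i + p i * multiplierDeriv α β σ v p i)
        - min α (α * β / 2) * (‖v - !₂[σ, 0, 0]‖ ^ 2 + ‖p‖ ^ 2) := by
  have hE : ‖v - !₂[σ, 0, 0]‖ ^ 2 = (v 0 - σ) ^ 2 + v 1 ^ 2 + v 2 ^ 2 := by
    rw [norm_sq_eq_sum]; simp
  have hs : v 0 ^ 2 + v 1 ^ 2 + v 2 ^ 2 = 1 := by rw [← norm_sq_eq_sum, hv, one_pow]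
  have hlow := lower_order_le (p0 := p 0) (p1 := p 1) (p2 := p 2) hα hβ hσ hs hvp hE hE1 hEα
  set E : ℝ := ‖v - !₂[σ, 0, 0]‖ ^ 2 with hEdef
  have hE0 : 0 ≤ E := sq_nonneg _
  have hcs : (v 0 * q 0 + v 1 * q 1 + v 2 * q 2) ^ 2 ≤ q 0 ^ 2 + q 1 ^ 2 + q 2 ^ 2 := by
    have : (v 0 * q 0 + v 1 * q 1 + v 2 * q 2) ^ 2
        ≤ (v 0 ^ 2 + v 1 ^ 2 + v 2 ^ 2) * (q 0 ^ 2 + q 1 ^ 2 + q 2 ^ 2) := by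
      nlinarith [sq_nonneg (v 0 * q 1 - v 1 * q 0), sq_nonneg (v 0 * q 2 - v 2 * q 0),
        sq_nonneg (v 1 * q 2 - v 2 * q 1)]
    rwa [hs, one_mul] at this
  have hcs' := mul_le_mul_of_nonneg_left hcs hα.le
  have hid : inner ℝ (llRHS α β 0 v q) ((2 : ℝ) • (v - !₂[σ, 0, 0]) - (2 : ℝ) • q)
      = 2 * (q 0 * multiplier α β σ v 0 + q 1 * multiplier α β σ v 1
          + q 2 * multiplier α β σ v 2
        - α * (σ * v 0) * (p 0 ^ 2 + p 1 ^ 2 + p 2 ^ 2 + β * (v 1 ^ 2 + v 2 ^ 2))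
        + α * β * (p 0 ^ 2 + p 1 ^ 2 + p 2 ^ 2) * (v 1 ^ 2 + v 2 ^ 2)
        - α * (q 0 ^ 2 + q 1 ^ 2 + q 2 ^ 2)
        + α * (v 0 * q 0 + v 1 * q 1 + v 2 * q 2) ^ 2) := by
    rw [inner_eq_sum]
    simp only [llRHS, cross, crossProduct, LinearMap.mk₂_apply, PiLp.sub_apply, PiLp.smul_apply,
      PiLp.add_apply, PiLp.zero_apply, smul_eq_mul, Matrix.cons_val_zero, Matrix.cons_val_one,
      Matrix.cons_val, multiplier]
    -- `|v|² = 1` enters through `v × (v × h) = (v · h) v - |v|² h`, and `v · q = -|p|²` through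
    -- `v · h = v · q - β (v₁² + v₂²)`
    linear_combination 2 * (-α * (σ * q 0) - α * (q 0 ^ 2 + q 1 ^ 2 + q 2 ^ 2
      - β * (v 1 * q 1 + v 2 * q 2))) * hs + 2 * (α * (σ * v 0) - α * β * (v 1 ^ 2 + v 2 ^ 2)) * hvq
  have hdiv : p 0 * multiplierDeriv α β σ v p 0 + p 1 * multiplierDeriv α β σ v p 1
      + p 2 * multiplierDeriv α β σ v p 2
      = β * (p 0 * (v 1 * p 2 - v 2 * p 1)) + α * β * (p 1 ^ 2 + p 2 ^ 2) := by
    simp only [multiplierDeriv, Matrix.cons_val_zero, Matrix.cons_val_one, Matrix.cons_val]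
    ring
  have hp0 : 0 ≤ p 0 ^ 2 + p 1 ^ 2 + p 2 ^ 2 := by positivity
  have m1 : min α (α * β / 2) * E ≤ α * β / 2 * E :=
    mul_le_mul_of_nonneg_right (min_le_right _ _) hE0
  have m2 : min α (α * β / 2) * (p 0 ^ 2 + p 1 ^ 2 + p 2 ^ 2)
      ≤ α * (p 0 ^ 2 + p 1 ^ 2 + p 2 ^ 2) := mul_le_mul_of_nonneg_right (min_le_left _ _) hp0
  rw [hid, Fin.sum_univ_three, norm_sq_eq_sum p]
  linarith

theorem val_sub_constH1 {a b : ℝ} (u : H1 a b) (ζ : R3) :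
    val (u - constH1 a b ζ) = val u - constL2 a b ζ := rfl

theorem weakD_sub_constH1 {a b : ℝ} (u : H1 a b) (ζ : R3) :
    weakD (u - constH1 a b ζ) = weakD u :=
  sub_zero (weakD u)

theorem inner_H1_eq {a b : ℝ} (u v : H1 a b) :
    inner ℝ u v = inner ℝ (val u) (val v) + inner ℝ (weakD u) (weakD v) :=
  WithLp.prod_inner_apply (u : WithLp 2 (L2 a b × L2 a b)) v

theorem norm_sq_H1_eq {a b : ℝ} (u : H1 a b) : ‖u‖ ^ 2 = ‖val u‖ ^ 2 + ‖weakD u‖ ^ 2 := by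
  rw [← real_inner_self_eq_norm_sq, inner_H1_eq, real_inner_self_eq_norm_sq,
    real_inner_self_eq_norm_sq]

theorem norm_sq_L2_eq {a b : ℝ} (u : L2 a b) : ‖u‖ ^ 2 = ∫ x in Ioo a b, ‖u x‖ ^ 2 := by
  rw [← real_inner_self_eq_norm_sq, L2.inner_def]
  simp only [real_inner_self_eq_norm_sq]

theorem integrable_norm_sq_L2 {a b : ℝ} (u : L2 a b) :
    Integrable (fun x => ‖u x‖ ^ 2) (volume.restrict (Ioo a b)) :=
  (memLp_two_iff_integrable_sq_norm (Lp.aestronglyMeasurable u)).1 (Lp.memLp u)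

theorem coeFn_sub_constL2 {a b : ℝ} (u : L2 a b) (ζ : R3) :
    ∀ᵐ x ∂volume.restrict (Ioo a b), (u - constL2 a b ζ : L2 a b) x = u x - ζ := by
  filter_upwards [Lp.coeFn_sub u (constL2 a b ζ),
    (memLp_const (μ := volume.restrict (Ioo a b)) (p := 2) ζ).coeFn_toLp] with x h1 h2
  rw [h1, Pi.sub_apply, constL2, h2]

/-- The first two spatial derivatives of `|v|² = 1`. The absolutely continuous representatives `V` of
`v` and `P` of `Dv` satisfy the undifferentiated identities everywhere, by continuity, so these can
be differentiated wherever `V` and `P` can. -/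
theorem ae_orthogonality_of_norm_eq_one {a b : ℝ} {v p q : ℝ → R3} {V P : Fin 3 → ℝ → ℝ}
    (hab : a < b) (hV : ∀ i, AbsolutelyContinuousOnInterval (V i) a b)
    (hP : ∀ i, AbsolutelyContinuousOnInterval (P i) a b)
    (hVe : ∀ᵐ x ∂volume.restrict (Ioo a b), ∀ i, v x i = V i x ∧ HasDerivAt (V i) (p x i) x)
    (hPe : ∀ᵐ x ∂volume.restrict (Ioo a b), ∀ i, p x i = P i x ∧ HasDerivAt (P i) (q x i) x)
    (hv : ∀ᵐ x ∂volume.restrict (Ioo a b), ‖v x‖ = 1) :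
    ∀ᵐ x ∂volume.restrict (Ioo a b), v x 0 * p x 0 + v x 1 * p x 1 + v x 2 * p x 2 = 0 ∧
      v x 0 * q x 0 + v x 1 * q x 1 + v x 2 * q x 2
        = -(p x 0 ^ 2 + p x 1 ^ 2 + p x 2 ^ 2) := by
  have eq_near : ∀ {f g : ℝ → ℝ}, ContinuousOn f (uIcc a b) → ContinuousOn g (uIcc a b) →
      (∀ᵐ x ∂volume.restrict (Ioo a b), f x = g x) → ∀ x ∈ Ioo a b, f =ᶠ[𝓝 x] g := by
    intro f g hf hg h x hx
    rw [uIcc_of_le hab.le] at hf hg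
    rw [restrict_Ioo_eq_restrict_Icc] at h
    have := Measure.eqOn_Icc_of_ae_eq volume hab.ne h hf hg
    filter_upwards [isOpen_Ioo.mem_nhds hx] with z hz using this (Ioo_subset_Icc_self hz)
  have cV := fun i => (hV i).continuousOn
  have cP := fun i => (hP i).continuousOn
  have e1 : ∀ x ∈ Ioo a b, (fun x => V 0 x * V 0 x + V 1 x * V 1 x + V 2 x * V 2 x)
      =ᶠ[𝓝 x] fun _ => 1 := by
    refine eq_near ((((cV 0).mul (cV 0)).add ((cV 1).mul (cV 1))).add ((cV 2).mul (cV 2)))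
      continuousOn_const ?_
    filter_upwards [hVe, hv] with x h1 h2
    have := norm_sq_eq_sum (v x)
    rw [h2, (h1 0).1, (h1 1).1, (h1 2).1] at this
    linarith
  have e2 : ∀ᵐ x ∂volume.restrict (Ioo a b), V 0 x * P 0 x + V 1 x * P 1 x + V 2 x * P 2 x = 0 := by
    filter_upwards [hVe, hPe, ae_restrict_mem measurableSet_Ioo] with x h1 h2 hx
    have d := (((h1 0).2.mul (h1 0).2).add ((h1 1).2.mul (h1 1).2)).add ((h1 2).2.mul (h1 2).2)
    have := (d.congr_of_eventuallyEq (e1 x hx).symm).unique (hasDerivAt_const x (1 : ℝ))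
    rw [(h2 0).1, (h2 1).1, (h2 2).1] at this
    linarith
  have e3 := eq_near ((((cV 0).mul (cP 0)).add ((cV 1).mul (cP 1))).add ((cV 2).mul (cP 2)))
      continuousOn_const e2
  filter_upwards [hVe, hPe, ae_restrict_mem measurableSet_Ioo, e2] with x h1 h2 hx h3
  have d := (((h1 0).2.mul (h2 0).2).add ((h1 1).2.mul (h2 1).2)).add ((h1 2).2.mul (h2 2).2)
  have := (d.congr_of_eventuallyEq (e3 x hx).symm).unique (hasDerivAt_const x (0 : ℝ))
  rw [(h1 0).1, (h1 1).1, (h1 2).1, (h2 0).1, (h2 1).1, (h2 2).1]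
  rw [(h2 0).1, (h2 1).1, (h2 2).1] at this
  exact ⟨h3, by linarith⟩

/-- The dissipation at a fixed time, for a magnetization that is uniformly close to the
pole `(σ, 0, 0)`. -/
theorem inner_le_neg_mul_norm_sq {a b α β σ : ℝ} (hab : a < b) (hα : 0 < α) (hβ : 0 < β)
    (hσ : σ ^ 2 = 1) {u : H1 a b} {q F : L2 a b} (hN : IsNeumannLaplacian u q)
    (hu : ∀ᵐ x ∂volume.restrict (Ioo a b), ‖val u x‖ = 1)
    (hF : F =ᵐ[volume.restrict (Ioo a b)] fun x => llRHS α β 0 (val u x) (q x))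
    {E : ℝ} (hE1 : E ≤ 1) (hEα : E * (1 + 2 * α) ≤ α)
    (hE : ∀ᵐ x ∂volume.restrict (Ioo a b), ‖val u x - !₂[σ, 0, 0]‖ ^ 2 ≤ E) :
    inner ℝ F ((2 : ℝ) • (val u - constL2 a b !₂[σ, 0, 0]) - (2 : ℝ) • q)
      ≤ -(min α (α * β / 2)) * ‖u - constH1 a b !₂[σ, 0, 0]‖ ^ 2 := by
  have hv : IsWeakDeriv (val u) (weakD u) := u.2
  choose V hV hVe using fun i => hv.exists_primitive hab i
  choose P hP hPa hPb hPe using fun i => hN.exists_primitive hab i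
  have hVe' := ae_all_iff.2 hVe
  have hPe' := ae_all_iff.2 hPe
  have hort := ae_orthogonality_of_norm_eq_one hab hV hP hVe' hPe' hu
  have hconst : ∀ c : ℝ, AbsolutelyContinuousOnInterval (fun _ : ℝ => c) a b := fun c =>
    contDiff_const.contDiffOn.absolutelyContinuousOnInterval
  have hM : ∀ i, AbsolutelyContinuousOnInterval
      (fun x => multiplier α β σ (fun j => V j x) i) a b := by
    have m0 := hconst (-(α * σ))
    have m1 := ((((hV 0).fun_mul (hV 2)).const_mul β).fun_neg.fun_add
      ((hV 1).const_mul (α * β))).fun_add ((hV 2).const_mul σ)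
    have m2 := ((((hV 0).fun_mul (hV 1)).const_mul β).fun_add
      ((hV 2).const_mul (α * β))).fun_sub ((hV 1).const_mul σ)
    intro i
    fin_cases i
    · exact m0
    · exact m1
    · exact m2
  have hMd : ∀ᵐ x ∂volume.restrict (Ioo a b), ∀ i,
      HasDerivAt (fun x => multiplier α β σ (fun j => V j x) i)
        (multiplierDeriv α β σ (val u x) (weakD u x) i) x := by
    filter_upwards [hVe'] with x h1
    have m0 := hasDerivAt_const x (-(α * σ))
    have m1 := ((((h1 0).2.mul (h1 2).2).const_mul β).neg.add
      ((h1 1).2.const_mul (α * β))).add ((h1 2).2.const_mul σ)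
    have m2 := ((((h1 0).2.mul (h1 1).2).const_mul β).add
      ((h1 2).2.const_mul (α * β))).sub ((h1 1).2.const_mul σ)
    intro i
    fin_cases i
    · exact m0
    · refine m1.congr_deriv ?_
      rw [← (h1 0).1, ← (h1 2).1]
      rfl
    · refine m2.congr_deriv ?_
      rw [← (h1 0).1, ← (h1 1).1]
      rfl
  have hB : AbsolutelyContinuousOnInterval (fun x =>
      P 0 x * multiplier α β σ (fun j => V j x) 0 + P 1 x * multiplier α β σ (fun j => V j x) 1
        + P 2 x * multiplier α β σ (fun j => V j x) 2) a b :=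
    (((hP 0).fun_mul (hM 0)).fun_add ((hP 1).fun_mul (hM 1))).fun_add ((hP 2).fun_mul (hM 2))
  obtain ⟨hDi, hD⟩ := integral_eq_zero_of_primitive hab hB
    (D := fun x => ∑ i, (q x i * multiplier α β σ (val u x) i
      + weakD u x i * multiplierDeriv α β σ (val u x) (weakD u x) i))
    (by simp [hPa]) (by simp [hPb]) (by
      filter_upwards [hVe', hPe', hMd] with x h1 h2 h3
      refine ((((h2 0).2.mul (h3 0)).add ((h2 1).2.mul (h3 1))).add
        ((h2 2).2.mul (h3 2))).congr_deriv ?_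
      have hvx : (fun j => V j x) = (val u x).ofLp := funext fun j => (h1 j).1.symm
      rw [Fin.sum_univ_three, hvx, (h2 0).1, (h2 1).1, (h2 2).1])
  set ζ : R3 := !₂[σ, 0, 0] with hζ
  have hw := coeFn_sub_constL2 (val u) ζ
  have i1 := integrable_norm_sq_L2 (val u - constL2 a b ζ)
  have i2 := integrable_norm_sq_L2 (weakD u)
  rw [norm_sq_H1_eq, val_sub_constH1, weakD_sub_constH1, norm_sq_L2_eq, norm_sq_L2_eq,
    ← integral_add i1 i2, L2.inner_def]
  have i12 : Integrable (fun x => ‖(val u - constL2 a b ζ : L2 a b) x‖ ^ 2 + ‖weakD u x‖ ^ 2)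
      (volume.restrict (Ioo a b)) := i1.add i2
  set c := min α (α * β / 2) with hc
  have hrhs : -c * ∫ x in Ioo a b, (‖(val u - constL2 a b ζ : L2 a b) x‖ ^ 2 + ‖weakD u x‖ ^ 2)
      = ∫ x in Ioo a b, (2 * (∑ i, (q x i * multiplier α β σ (val u x) i
      + weakD u x i * multiplierDeriv α β σ (val u x) (weakD u x) i))
      - c * (‖(val u - constL2 a b ζ : L2 a b) x‖ ^ 2 + ‖weakD u x‖ ^ 2)) := by
    rw [integral_sub (hDi.const_mul 2) (i12.const_mul c), integral_const_mul,
      integral_const_mul, hD]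
    ring
  rw [hrhs]
  refine integral_mono_ae (L2.integrable_inner (𝕜 := ℝ) _ _)
    ((hDi.const_mul 2).sub (i12.const_mul c)) ?_
  filter_upwards [hF, hu, hort, hE, hw,
    Lp.coeFn_sub ((2 : ℝ) • (val u - constL2 a b ζ)) ((2 : ℝ) • q),
    Lp.coeFn_smul (2 : ℝ) (val u - constL2 a b ζ), Lp.coeFn_smul (2 : ℝ) q]
    with x h1 h2 h3 h4 h5 h6 h7 h8
  simp only [h6, Pi.sub_apply, h7, h8, Pi.smul_apply, h5, h1]
  refine inner_llRHS_le hα hβ hσ h2 h3.1 h3.2 (h4.trans hE1) (le_trans ?_ hEα)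
  exact mul_le_mul_of_nonneg_right h4 (by linarith)

/-! ### Decay of the `H¹` distance to the pole -/

theorem norm_sq_llRHS_le {α β : ℝ} {v : R3} (hv : ‖v‖ = 1) (w : R3) :
    ‖llRHS α β 0 v w‖ ^ 2 ≤ 2 * (1 + α ^ 2) * (‖w‖ ^ 2 + β ^ 2) := by
  have hs : v 0 ^ 2 + v 1 ^ 2 + v 2 ^ 2 = 1 := by rw [← norm_sq_eq_sum, hv, one_pow]
  have hid : ‖llRHS α β 0 v w‖ ^ 2
      = (1 + α ^ 2 * (v 0 ^ 2 + v 1 ^ 2 + v 2 ^ 2)) * ((v 0 ^ 2 + v 1 ^ 2 + v 2 ^ 2) *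
        (w 0 ^ 2 + (w 1 - β * v 1) ^ 2 + (w 2 - β * v 2) ^ 2)
        - (v 0 * w 0 + v 1 * (w 1 - β * v 1) + v 2 * (w 2 - β * v 2)) ^ 2) := by
    rw [norm_sq_eq_sum]
    simp only [llRHS, cross, crossProduct, LinearMap.mk₂_apply, PiLp.sub_apply, PiLp.smul_apply,
      PiLp.add_apply, PiLp.zero_apply, smul_eq_mul, Matrix.cons_val_zero, Matrix.cons_val_one,
      Matrix.cons_val]
    ring
  rw [hid, hs, norm_sq_eq_sum w]
  have h1 : w 0 ^ 2 + (w 1 - β * v 1) ^ 2 + (w 2 - β * v 2) ^ 2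
      ≤ 2 * (w 0 ^ 2 + w 1 ^ 2 + w 2 ^ 2 + β ^ 2) := by
    have h2 : β ^ 2 * (v 1 ^ 2 + v 2 ^ 2) ≤ β ^ 2 * 1 :=
      mul_le_mul_of_nonneg_left (by nlinarith [sq_nonneg (v 0)]) (sq_nonneg β)
    nlinarith [sq_nonneg (w 1 + β * v 1), sq_nonneg (w 2 + β * v 2), sq_nonneg (w 0)]
  have h3 : 0 ≤ 1 + α ^ 2 := by positivity
  nlinarith [mul_le_mul_of_nonneg_left h1 h3,
    mul_nonneg h3 (sq_nonneg (v 0 * w 0 + v 1 * (w 1 - β * v 1) + v 2 * (w 2 - β * v 2)))]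

theorem norm_sq_le_of_llRHS {a b α β : ℝ} (hab : a < b) {v q F : L2 a b}
    (hv : ∀ᵐ x ∂volume.restrict (Ioo a b), ‖v x‖ = 1)
    (hF : F =ᵐ[volume.restrict (Ioo a b)] fun x => llRHS α β 0 (v x) (q x)) :
    ‖F‖ ^ 2 ≤ 2 * (1 + α ^ 2) * (‖q‖ ^ 2 + β ^ 2 * (b - a)) := by
  have iq : Integrable (fun x => ‖q x‖ ^ 2 + β ^ 2) (volume.restrict (Ioo a b)) :=
    (integrable_norm_sq_L2 q).add (integrable_const _)
  have e : 2 * (1 + α ^ 2) * (‖q‖ ^ 2 + β ^ 2 * (b - a))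
      = ∫ x in Ioo a b, 2 * (1 + α ^ 2) * (‖q x‖ ^ 2 + β ^ 2) := by
    rw [integral_const_mul, integral_add (integrable_norm_sq_L2 q) (integrable_const _),
      ← norm_sq_L2_eq, setIntegral_const]
    simp [hab.le, mul_comm]
  rw [e, norm_sq_L2_eq]
  refine integral_mono_ae (integrable_norm_sq_L2 F) (iq.const_mul _) ?_
  filter_upwards [hv, hF] with x h1 h2
  simp only [h2]
  exact norm_sq_llRHS_le h1 _

theorem continuous_val {a b : ℝ} : Continuous (val : H1 a b → L2 a b) := by
  unfold val
  fun_prop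

/-- Weak derivatives are unique. -/
theorem val_injective {a b : ℝ} : Function.Injective (val : H1 a b → L2 a b) := by
  intro u v huv
  have hg : weakD u = weakD v := by
    refine Lp.ext ?_
    have hi : IntegrableOn (fun x => weakD u x - weakD v x) (Ioo a b) :=
      ((Lp.memLp (weakD u)).sub (Lp.memLp (weakD v))).integrable one_le_two
    have h := isOpen_Ioo.ae_eq_zero_of_integral_contDiff_smul_eq_zero (μ := volume)
      hi.locallyIntegrableOn (by
        intro φ h1 h2 h3
        rw [← setIntegral_eq_integral_of_forall_compl_eq_zero (s := Ioo a b)]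
        · have e1 := u.2 φ h1 h2 h3
          have e2 := v.2 φ h1 h2 h3
          change ∫ x in Ioo a b, deriv φ x • val u x = -∫ x in Ioo a b, φ x • weakD u x at e1
          change ∫ x in Ioo a b, deriv φ x • val v x = -∫ x in Ioo a b, φ x • weakD v x at e2
          simp only [smul_sub]
          rw [integral_sub (integrable_smul_L2 h1.continuous h2 _)
            (integrable_smul_L2 h1.continuous h2 _), sub_eq_zero]
          rw [huv, e2] at e1
          exact (neg_injective e1).symm
        · intro x hx
          rw [image_eq_zero_of_notMem_tsupport fun h => hx (h3 h), zero_smul])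
    rw [Filter.EventuallyEq, ae_restrict_iff' measurableSet_Ioo]
    filter_upwards [h] with x hx hxm
    exact sub_eq_zero.1 (hx hxm)
  refine Subtype.ext (WithLp.ofLp_injective 2 ?_)
  exact Prod.ext huv hg

theorem norm_val_le {a b : ℝ} (u : H1 a b) : ‖val u‖ ≤ ‖u‖ := by
  have h := norm_sq_H1_eq u
  exact le_of_sq_le_sq (by nlinarith [sq_nonneg ‖weakD u‖]) (norm_nonneg u)

theorem norm_constL2 {a b : ℝ} (hab : a < b) {ζ : R3} (hζ : ‖ζ‖ = 1) :
    ‖constL2 a b ζ‖ = √(b - a) := by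
  have h : ‖constL2 a b ζ‖ ^ 2 = b - a := by
    rw [norm_sq_L2_eq]
    have : ∫ x in Ioo a b, ‖(constL2 a b ζ) x‖ ^ 2 = ∫ x in Ioo a b, (1 : ℝ) := by
      refine integral_congr_ae ?_
      filter_upwards [(memLp_const (μ := volume.restrict (Ioo a b)) (p := 2) ζ).coeFn_toLp]
        with x hx
      rw [constL2, hx, hζ, one_pow]
    rw [this, setIntegral_const]
    simp [hab.le]
  rw [← h, Real.sqrt_sq (norm_nonneg _)]

theorem norm_constH1 {a b : ℝ} (hab : a < b) {ζ : R3} (hζ : ‖ζ‖ = 1) :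
    ‖constH1 a b ζ‖ = √(b - a) := by
  have h := norm_sq_H1_eq (constH1 a b ζ)
  have h1 : val (constH1 a b ζ) = constL2 a b ζ := rfl
  have h2 : weakD (constH1 a b ζ) = 0 := rfl
  rw [h1, h2, norm_zero, norm_constL2 hab hζ] at h
  have h3 : ‖constH1 a b ζ‖ ^ 2 = √(b - a) ^ 2 := by rw [h]; ring
  exact (sq_eq_sq₀ (norm_nonneg _) (Real.sqrt_nonneg _)).1 h3

/-- The Sobolev constant is at least `|Λ|^(-1/2)`, as the constant functions show. -/
theorem one_le_mul_sqrt_of_interpolation {a b k : ℝ} (hab : a < b)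
    (hinterp : ∀ u : H1 a b, ∀ᵐ x ∂(volume.restrict (Ioo a b)),
      ‖val u x‖ ≤ k * ‖val u‖ ^ (1 / 2 : ℝ) * ‖u‖ ^ (1 / 2 : ℝ)) {ζ : R3} (hζ : ‖ζ‖ = 1) :
    1 ≤ k * √(b - a) := by
  have hne : (ae (volume.restrict (Ioo a b))).NeBot := by
    rw [ae_neBot, Ne, Measure.restrict_eq_zero, Real.volume_Ioo]
    simpa using hab
  obtain ⟨x, h1, h2⟩ := ((hinterp (constH1 a b ζ)).and
    (memLp_const (μ := volume.restrict (Ioo a b)) (p := 2) ζ).coeFn_toLp).exists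
  have h3 : val (constH1 a b ζ) = constL2 a b ζ := rfl
  rw [norm_constH1 hab hζ, h3, norm_constL2 hab hζ, constL2, h2, hζ, mul_assoc,
    ← Real.rpow_add_of_nonneg (Real.sqrt_nonneg _) (by norm_num) (by norm_num)] at h1
  norm_num at h1
  exact h1

theorem ae_norm_le_of_interpolation {a b k : ℝ} (hk : 0 < k)
    (hinterp : ∀ u : H1 a b, ∀ᵐ x ∂(volume.restrict (Ioo a b)),
      ‖val u x‖ ≤ k * ‖val u‖ ^ (1 / 2 : ℝ) * ‖u‖ ^ (1 / 2 : ℝ)) (u : H1 a b) :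
    ∀ᵐ x ∂(volume.restrict (Ioo a b)), ‖val u x‖ ≤ k * ‖u‖ := by
  filter_upwards [hinterp u] with x hx
  refine hx.trans ?_
  rw [mul_assoc]
  refine mul_le_mul_of_nonneg_left ?_ hk.le
  calc ‖val u‖ ^ (1 / 2 : ℝ) * ‖u‖ ^ (1 / 2 : ℝ)
      ≤ ‖u‖ ^ (1 / 2 : ℝ) * ‖u‖ ^ (1 / 2 : ℝ) := by
        gcongr
        exact norm_val_le u
    _ = ‖u‖ := by
        rw [← Real.rpow_add_of_nonneg (norm_nonneg _) (by norm_num) (by norm_num)]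
        norm_num

/-- At an element `u` of `D(A)`, the squared `H¹` distance to a constant has an `L²` subgradient. -/
theorem norm_sq_sub_norm_sq_le {a b : ℝ} (hab : a < b) {u : H1 a b} {q : L2 a b}
    (hN : IsNeumannLaplacian u q) (v : H1 a b) (ζ : R3) :
    ‖u - constH1 a b ζ‖ ^ 2 - ‖v - constH1 a b ζ‖ ^ 2
      ≤ inner ℝ (val u - val v) ((2 : ℝ) • (val u - constL2 a b ζ) - (2 : ℝ) • q) := by
  have h1 := norm_sub_sq_real (u - constH1 a b ζ) (u - v)
  have h2 : u - constH1 a b ζ - (u - v) = v - constH1 a b ζ := by abel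
  have hg := hN.inner_eq_neg hab (u - v)
  have h3 := inner_H1_eq (u - v) (u - constH1 a b ζ)
  have h4 : val (u - v) = val u - val v := rfl
  rw [weakD_sub_constH1, val_sub_constH1, h4] at h3
  rw [h4] at hg
  rw [h2, real_inner_comm, h3] at h1
  rw [inner_sub_right, inner_smul_right, inner_smul_right]
  nlinarith [sq_nonneg ‖u - v‖]

/-- The energy inequality: while the solution stays uniformly close to the pole, its squared
`H¹` distance to the pole decreases at a rate proportional to itself. -/
theorem IsSolution.norm_sq_sub_le {a b α β σ : ℝ} (hab : a < b) (hα : 0 < α) (hβ : 0 < β)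
    (hσ : σ ^ 2 = 1) {u₀ : H1 a b}
    (hu₀ : ∀ᵐ x ∂(volume.restrict (Ioo a b)), ‖val u₀ x‖ = 1) {y : ℝ → H1 a b}
    (hy : IsSolution α β (fun _ => 0) u₀ y) {E : ℝ} (hE1 : E ≤ 1) (hEα : E * (1 + 2 * α) ≤ α)
    {s τ : ℝ} (hs : 0 ≤ s) (hst : s < τ)
    (hE : ∀ t ∈ Ioo s τ, ∀ᵐ x ∂volume.restrict (Ioo a b),
      ‖val (y t) x - !₂[σ, 0, 0]‖ ^ 2 ≤ E) :
    ‖y τ - constH1 a b !₂[σ, 0, 0]‖ ^ 2 - ‖y s - constH1 a b !₂[σ, 0, 0]‖ ^ 2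
      ≤ -(min α (α * β / 2)) * ∫ t in Ioo s τ, ‖y t - constH1 a b !₂[σ, 0, 0]‖ ^ 2 := by
  obtain ⟨hyc, q, F, hN, hq, hF, hint⟩ := hy
  set ζ : R3 := !₂[σ, 0, 0] with hζ
  have hone : ∀ t : ℝ, 0 ≤ t → ∀ᵐ x ∂volume.restrict (Ioo a b), ‖val (y t) x‖ = 1 :=
    fun t ht => ae_norm_eq_one hu₀ (v := fun t => val (y t)) hF hint ht
  have hτ : 0 < τ := hs.trans_lt hst
  have hsubI : Ioo s τ ⊆ Ioi (0 : ℝ) := fun t ht => hs.trans_lt ht.1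
  have hsub : Ioo s τ ⊆ Ioo 0 τ := fun t ht => ⟨hs.trans_lt ht.1, ht.2⟩
  have hN' := ae_restrict_of_ae_restrict_of_subset hsubI hN
  have hF' := ae_restrict_of_ae_restrict_of_subset hsubI hF
  have hyI : ContinuousOn y (Icc s τ) := hyc.mono fun t ht => hs.trans ht.1
  have hqL : MemLp q 2 (volume.restrict (Ioo s τ)) :=
    (hq τ hτ).mono_measure (Measure.restrict_mono hsub le_rfl)
  have hFL : MemLp F 2 (volume.restrict (Ioo s τ)) := by
    have hm : AEStronglyMeasurable F (volume.restrict (Ioo s τ)) :=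
      (hint τ hτ.le).1.1.1.mono_measure
        (Measure.restrict_mono (hsub.trans Ioo_subset_Ioc_self) le_rfl)
    rw [memLp_two_iff_integrable_sq_norm hm]
    have hq2 : Integrable (fun t => ‖q t‖ ^ 2) (volume.restrict (Ioo s τ)) :=
      (memLp_two_iff_integrable_sq_norm hqL.1).1 hqL
    refine ((hq2.add (integrable_const (β ^ 2 * (b - a)))).const_mul (2 * (1 + α ^ 2))).mono'
      (hm.norm.pow 2) ?_
    filter_upwards [hF', ae_restrict_mem measurableSet_Ioo] with t h1 h2
    rw [Real.norm_of_nonneg (sq_nonneg _)]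
    exact norm_sq_le_of_llRHS hab (hone t (hsubI h2).le) h1
  have hwL : MemLp (fun t => (2 : ℝ) • (val (y t) - constL2 a b ζ) - (2 : ℝ) • q t) 2
      (volume.restrict (Ioo s τ)) := by
    have hc : ContinuousOn (fun t => val (y t) - constL2 a b ζ) (Icc s τ) :=
      (continuous_val.comp_continuousOn hyI).sub continuousOn_const
    obtain ⟨C, hC⟩ := isCompact_Icc.exists_bound_of_continuousOn hc
    have h1 : MemLp (fun t => val (y t) - constL2 a b ζ) 2 (volume.restrict (Ioo s τ)) := by
      refine MemLp.of_bound ((hc.mono Ioo_subset_Icc_self).aestronglyMeasurable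
        measurableSet_Ioo) C ?_
      filter_upwards [ae_restrict_mem measurableSet_Ioo] with t ht
      exact hC t (Ioo_subset_Icc_self ht)
    exact (h1.const_smul (2 : ℝ)).sub (hqL.const_smul (2 : ℝ))
  have hφ : ContinuousOn (fun t => ‖y t - constH1 a b ζ‖ ^ 2) (Icc s τ) :=
    ((hyI.sub continuousOn_const).norm).pow 2
  refine (sub_le_integral_inner_of_subgradient hst hφ hFL hwL ?_).trans ?_
  · filter_upwards [hN', ae_restrict_mem measurableSet_Ioo] with t h1 h2 r hr
    have hr0 : 0 ≤ r := hs.trans hr.1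
    have ht0 : 0 ≤ t := (hsubI h2).le
    have h3 : ∫ x in r..t, F x = val (y t) - val (y r) := by
      rw [(hint t ht0).2, (hint r hr0).2, add_sub_add_left_eq_sub,
        intervalIntegral.integral_interval_sub_left (hint t ht0).1 (hint r hr0).1]
    rw [h3]
    exact norm_sq_sub_norm_sq_le hab h1 (y r) ζ
  · rw [← integral_const_mul]
    have hi : Integrable (fun t => inner ℝ (F t)
        ((2 : ℝ) • (val (y t) - constL2 a b ζ) - (2 : ℝ) • q t)) (volume.restrict (Ioo s τ)) := by
      refine (((memLp_two_iff_integrable_sq_norm hFL.1).1 hFL).add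
        ((memLp_two_iff_integrable_sq_norm hwL.1).1 hwL)).mono' (hFL.1.inner hwL.1) ?_
      refine Eventually.of_forall fun t => ?_
      have := norm_inner_le_norm (𝕜 := ℝ) (F t)
        ((2 : ℝ) • (val (y t) - constL2 a b ζ) - (2 : ℝ) • q t)
      simp only [Pi.add_apply]
      nlinarith [sq_nonneg (‖F t‖ - ‖(2 : ℝ) • (val (y t) - constL2 a b ζ) - (2 : ℝ) • q t‖),
        sq_nonneg ‖F t‖, sq_nonneg ‖(2 : ℝ) • (val (y t) - constL2 a b ζ) - (2 : ℝ) • q t‖]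
    refine integral_mono_ae hi
      ((hφ.integrableOn_Icc.mono_set Ioo_subset_Icc_self).const_mul _) ?_
    filter_upwards [hN', hF', ae_restrict_mem measurableSet_Ioo] with t h1 h2 h3
    exact inner_le_neg_mul_norm_sq hab hα hβ hσ h1 (hone t (hsubI h3).le) h2 hE1 hEα (hE t h3)

/-- A nonnegative continuous function that satisfies `X' ≤ -c X` in integrated form as long as it
stays below a threshold, and starts below that threshold, tends to zero. -/
theorem tendsto_zero_of_conditional_decay {X : ℝ → ℝ} {c ρ : ℝ} (hc : 0 < c)
    (hX : ContinuousOn X (Ici 0)) (hX0 : ∀ t, 0 ≤ X t) (h0 : X 0 < ρ)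
    (h : ∀ s τ : ℝ, 0 ≤ s → s < τ → (∀ t ∈ Ioo s τ, X t < ρ) →
      X τ - X s ≤ -c * ∫ t in Ioo s τ, X t) :
    Tendsto X atTop (𝓝 0) := by
  have hint0 : ∀ s τ : ℝ, 0 ≤ ∫ t in Ioo s τ, X t := fun s τ => integral_nonneg fun t => hX0 t
  have hmono : ∀ s τ : ℝ, 0 ≤ s → s < τ → (∀ t ∈ Ioo s τ, X t < ρ) → X τ ≤ X s := by
    intro s τ hs hst hlt
    nlinarith [h s τ hs hst hlt, mul_nonneg hc.le (hint0 s τ)]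
  -- at a first time where `X` reaches `ρ` it would still be at most `X 0`
  have hlt : ∀ t : ℝ, 0 ≤ t → X t < ρ := by
    by_contra! hcon
    obtain ⟨t, ht, htρ⟩ := hcon
    set S : Set ℝ := Ici 0 ∩ X ⁻¹' Ici ρ with hS
    have hcl : IsClosed S := hX.preimage_isClosed_of_isClosed isClosed_Ici isClosed_Ici
    have hbdd : BddBelow S := ⟨0, fun r hr => hr.1⟩
    have hmem : sInf S ∈ S := hcl.csInf_mem ⟨t, ht, htρ⟩ hbdd
    have hpos : 0 < sInf S := by
      refine lt_of_le_of_ne hmem.1 fun he => ?_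
      have h1 : ρ ≤ X (sInf S) := hmem.2
      rw [← he] at h1
      linarith
    have h1 := hmono 0 (sInf S) le_rfl hpos fun r hr => by
      by_contra! hge
      exact absurd (csInf_le hbdd (show r ∈ S from ⟨hr.1.le, hge⟩)) (not_le.2 hr.2)
    have h2 : ρ ≤ X (sInf S) := hmem.2
    linarith
  have hbound : ∀ t : ℝ, 0 < t → X t ≤ X 0 / (1 + c * t) := by
    intro t ht
    have h1 := h 0 t le_rfl ht fun r hr => hlt r hr.1.le
    have h2 : t * X t ≤ ∫ r in Ioo 0 t, X r := by
      have e : t * X t = ∫ _r in Ioo 0 t, X t := by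
        rw [setIntegral_const]
        simp [ht.le]
      rw [e]
      refine setIntegral_mono_on (by simp) ?_ measurableSet_Ioo fun r hr =>
        hmono r t hr.1.le hr.2 fun z hz => hlt z (hr.1.trans hz.1).le
      exact (hX.mono fun r hr => hr.1).integrableOn_Icc.mono_set Ioo_subset_Icc_self
    rw [le_div_iff₀ (by positivity)]
    nlinarith [mul_le_mul_of_nonneg_left h2 hc.le]
  have hlim : Tendsto (fun t : ℝ => X 0 / (1 + c * t)) atTop (𝓝 0) :=
    tendsto_const_nhds.div_atTop
      (tendsto_atTop_add_const_left _ _ (tendsto_id.const_mul_atTop hc))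
  refine tendsto_of_tendsto_of_tendsto_of_le_of_le' tendsto_const_nhds hlim
    (Eventually.of_forall hX0) ?_
  filter_upwards [eventually_gt_atTop 0] with t ht using hbound t ht

theorem IsSolution.tendsto_constH1 {a b α β k σ : ℝ} (hab : a < b) (hα : 0 < α) (hβ : 0 < β)
    (hk : 0 < k)
    (hinterp : ∀ u : H1 a b, ∀ᵐ x ∂(volume.restrict (Ioo a b)),
      ‖val u x‖ ≤ k * ‖val u‖ ^ (1 / 2 : ℝ) * ‖u‖ ^ (1 / 2 : ℝ))
    {u₀ : H1 a b} (hu₀ : ∀ᵐ x ∂(volume.restrict (Ioo a b)), ‖val u₀ x‖ = 1) (hσ : σ ^ 2 = 1)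
    (hclose : ‖u₀ - constH1 a b !₂[σ, 0, 0]‖
      < 1 / (2 * k ^ 2 * √(b - a)) * (α / (1 + 2 * α)))
    {y : ℝ → H1 a b} (hy : IsSolution α β (fun _ => 0) u₀ y) :
    Tendsto y atTop (𝓝 (constH1 a b !₂[σ, 0, 0])) := by
  set ζ : R3 := !₂[σ, 0, 0] with hζ
  have hζ1 : ‖ζ‖ = 1 := by
    have : ‖ζ‖ ^ 2 = 1 := by rw [norm_sq_eq_sum, hζ]; simpa using hσ
    nlinarith [norm_nonneg ζ]
  have hkl := one_le_mul_sqrt_of_interpolation hab hinterp hζ1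
  set ρ : ℝ := 1 / (2 * k ^ 2 * √(b - a)) * (α / (1 + 2 * α)) with hρ
  have hl : 0 < √(b - a) := Real.sqrt_pos.2 (by linarith)
  have hρ0 : 0 < ρ := by positivity
  set θ : ℝ := α / (1 + 2 * α) with hθ
  have hθ0 : 0 < θ := by positivity
  have hθα : θ * (1 + 2 * α) = α := div_mul_cancel₀ _ (by positivity)
  have hθ1 : θ ≤ 1 := by
    rw [hθ, div_le_one (by positivity)]
    linarith
  have hkρ : k * ρ ≤ θ := by
    have e : k * ρ = θ / (2 * (k * √(b - a))) := by
      rw [hρ]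
      field_simp
    rw [e]
    exact div_le_self hθ0.le (by linarith)
  have hEθ : (k * ρ) ^ 2 ≤ θ := by
    have : 0 ≤ k * ρ := by positivity
    nlinarith
  -- the equation determines only the `L²` part of `y 0`
  have hy0 : y 0 = u₀ := by
    obtain ⟨-, q, F, -, -, -, hint⟩ := hy
    refine val_injective ?_
    simpa using (hint 0 le_rfl).2
  have hlim := tendsto_zero_of_conditional_decay (X := fun t => ‖y t - constH1 a b ζ‖ ^ 2)
    (c := min α (α * β / 2)) (ρ := ρ ^ 2) (lt_min hα (by positivity))
    (((hy.1.sub continuousOn_const).norm).pow 2) (fun t => sq_nonneg _)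
    (by
      simp only [hy0]
      exact pow_lt_pow_left₀ hclose (norm_nonneg _) two_ne_zero)
    (by
      intro s τ hs hst hlt
      refine hy.norm_sq_sub_le hab hα hβ hσ hu₀ (hEθ.trans hθ1) ?_ hs hst ?_
      · calc (k * ρ) ^ 2 * (1 + 2 * α) ≤ θ * (1 + 2 * α) := by gcongr
          _ = α := hθα
      · intro t ht
        have h1 : ‖y t - constH1 a b ζ‖ < ρ := lt_of_pow_lt_pow_left₀ 2 hρ0.le (hlt t ht)
        filter_upwards [ae_norm_le_of_interpolation hk hinterp (y t - constH1 a b ζ),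
          coeFn_sub_constL2 (val (y t)) ζ] with x h2 h3
        rw [val_sub_constH1, h3] at h2
        have h4 : ‖val (y t) x - ζ‖ ≤ k * ρ :=
          h2.trans (mul_le_mul_of_nonneg_left h1.le hk.le)
        gcongr)
  rw [tendsto_iff_norm_sub_tendsto_zero]
  have := hlim.sqrt
  simpa [Real.sqrt_sq (norm_nonneg _)] using this

end

end LandauLifshitz

theorem proposition10p2 (a b : ℝ) (hab : a < b) (α β : ℝ) (hα : 0 < α) (hβ : 0 < β)
    (k : ℝ) (hk : 0 < k)
    (hinterp : ∀ u : LandauLifshitz.H1 a b, ∀ᵐ x ∂(volume.restrict (Ioo a b)),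
      ‖LandauLifshitz.val u x‖ ≤ k * ‖LandauLifshitz.val u‖ ^ (1 / 2 : ℝ) * ‖u‖ ^ (1 / 2 : ℝ))
    (u₀ : LandauLifshitz.H1 a b) (hu₀ : ∀ᵐ x ∂(volume.restrict (Ioo a b)), ‖LandauLifshitz.val u₀ x‖ = 1)
    (ζ : LandauLifshitz.R3) (hζ : ζ = !₂[-1, 0, 0] ∨ ζ = !₂[1, 0, 0])
    (hclose : ‖u₀ - LandauLifshitz.constH1 a b ζ‖
      < 1 / (2 * k ^ 2 * Real.sqrt (b - a)) * (α / (1 + 2 * α)))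
    (y : ℝ → LandauLifshitz.H1 a b)
    (hy : LandauLifshitz.IsSolution α β (fun _ => 0) u₀ y) :
    Tendsto y atTop (𝓝 (LandauLifshitz.constH1 a b ζ)) := by
  rcases hζ with rfl | rfl
  · exact hy.tendsto_constH1 hab hα hβ hk hinterp hu₀ (by norm_num) hclose
  · exact hy.tendsto_constH1 hab hα hβ hk hinterp hu₀ (by norm_num) hclose
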